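/- Let $\mathbb F$ be a field of characteristic different from $2$. Let $\mathsf K_3=\mathbb F a\oplus W$ be the three-dimensional Kaplansky superalgebra: the even part is $\mathbb F a$, the odd part is $W=\mathbb F u\oplus\mathbb F v$ with the skew-symmetric bilinear form $(\cdot\mid\cdot)$ such that $(u\mid v)=1$, and $a^2=a$, $ax=xa=\tfrac12x$, $xy=(x\mid y)a$ for $x,y\in W$. Extend the form to $\mathsf K_3$ by $(a\mid a)=\tfrac12$ and $(a\mid W)=(W\mid a)=0$. Kac's superalgebra is $\mathsf K_{10}=\mathbb F1\oplus(\mathsf K_3\otimes\mathsf K_3)$, with even part $\mathbb F1\oplus\mathbb F(a\otimes a)\oplus(W\otimes W)$ and odd part $(W\otimes a)\oplus(a\otimes W)$, where $1$ is the unity and $$(x\otimes y)(z\otimes t)=(-1)^{|y||z|}\Bigl(xz\otimes yt-\tfrac34(x\mid z)(y\mid t)1\Bigr)$$ for homogeneous $x,y,z,t\in\mathsf K_3$. For an abelian group $G$, a $G$-grading on $\mathsf K_{10}$ is a decomposition $\mathsf K_{10}=\bigoplus_{g\in G}A_g$ into subspaces, each the direct sum of its intersections with the even and the odd part, with $A_gA_h\subseteq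 A_{gh}$ for all $g,h$. Two $G$-gradings $(A_g)$, $(A'_g)$ are isomorphic if some automorphism $\varphi$ of the superalgebra $\mathsf K_{10}$ satisfies $\varphi(A_g)=A'_g$ for all $g\in G$. Gradings by possibly different abelian groups are equivalent if some automorphism of $\mathsf K_{10}$ maps the nonzero homogeneous components of the first onto those of the second. A grading is fine if it has no proper refinement, that is, there is no grading by an abelian group each of whose components lies in a component of the given one, with strict inclusion for at least one nonzero component. Let $G$ be an abelian group with neutral element $e$. For $g_1,g_2\in G$ there is a unique $G$-grading $\Gamma^1_{\mathsf K_{10}}(G;g_1,g_2)$ with $$\deg(u\otimes a)=g_1=\deg(v\otimes a)^{-1},\qquad \deg(a\otimes u)=g_2=\deg(a\otimes v)^{-1},$$ and for $g,h\in G$ with $h^2=e\neq h$ there is a unique $G$-grading $\Gamma^2_{\mathsf K_{10}}(G;g,h)$ with $$\deg(u\otimes a+a\otimes u)=g=\deg(v\otimes a+a\otimes v)^{-1},\qquad \deg(u\otimes a-a\otimes u)=gh=\deg(v\otimes a-a\otimes v)^{-1}.$$ Theorem. Any $G$-grading on $\mathsf K_{10}$ is isomorphic to some $\Gamma^1_{\mathsf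 K_{10}}(G;g_1,g_2)$ or to some $\Gamma^2_{\mathsf K_{10}}(G;g,h)$ with $h^2=e\neq h$. No grading of the first type is isomorphic to a grading of the second type. Moreover: - $\Gamma^1_{\mathsf K_{10}}(G;g_1,g_2)$ and $\Gamma^1_{\mathsf K_{10}}(G;g_1',g_2')$ are isomorphic if and only if the sets $\{g_1,g_1^{-1},g_2,g_2^{-1}\}$ and $\{g_1',(g_1')^{-1},g_2',(g_2')^{-1}\}$ coincide; - $\Gamma^2_{\mathsf K_{10}}(G;g,h)$ and $\Gamma^2_{\mathsf K_{10}}(G;g',h')$ (with $h^2=e\neq h$ and $h'^2=e\neq h'$) are isomorphic if and only if $h'=h$ and $g'\in\{g,gh,g^{-1},g^{-1}h\}$. Finally, there are exactly two fine gradings on $\mathsf K_{10}$ up to equivalence: $\Gamma^1_{\mathsf K_{10}}\bigl(\mathbb Z^2;(1,0),(0,1)\bigr)$ and $\Gamma^2_{\mathsf K_{10}}\bigl(\mathbb Z\times\mathbb Z/2\mathbb Z;(1,\bar0),(0,\bar1)\bigr)$ are fine and inequivalent, and every fine grading of $\mathsf K_{10}$ by an abelian group is equivalent to one of them. -/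

import Mathlib

open scoped TensorProduct

universe u v w

noncomputable section

namespace Kac

/-! ### The three-dimensional Kaplansky superalgebra -/

/-- `K3 F = F a ⊕ W`, with `W = F²`: the pair `(α, w)` stands for `α a + w`. -/
abbrev K3 (F : Type w) [Field F] : Type w := F × (Fin 2 → F)

variable (F : Type w) [Field F]

namespace K3

/-- The even basis element `a`. -/
def a : K3 F := (1, 0)

/-- The odd element attached to a vector of `W`. -/
def odd {F : Type w} [Field F] (x : Fin 2 → F) : K3 F := (0, x)

/-- First vector of the symplectic basis of `W`. -/
def u : K3 F := odd ![1, 0]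

/-- Second vector of the symplectic basis of `W`; `(u | v) = 1`. -/
def v : K3 F := odd ![0, 1]

/-- The nonzero skew-symmetric form on `W`. -/
def skew {F : Type w} [Field F] (x y : Fin 2 → F) : F := x 0 * y 1 - x 1 * y 0

/-- The product of `K3`: `a a = a`, `a x = x a = (1/2) x`, `x y = (x | y) a` for `x, y ∈ W`. -/
def mul : K3 F →ₗ[F] K3 F →ₗ[F] K3 F :=
  LinearMap.mk₂ F
    (fun p q => (p.1 * q.1 + skew p.2 q.2, (1 / 2 : F) • (p.1 • q.2 + q.1 • p.2)))
    (by intro p p' q; ext <;> simp [skew] <;> ring)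
    (by intro c p q; ext <;> simp [skew] <;> ring)
    (by intro p q q'; ext <;> simp [skew] <;> ring)
    (by intro c p q; ext <;> simp [skew] <;> ring)

/-- The supersymmetric form on `K3`: `(a | a) = 1/2`, `(a | W) = (W | a) = 0`, and the given
skew-symmetric form on `W`. -/
def form : K3 F →ₗ[F] K3 F →ₗ[F] F :=
  LinearMap.mk₂ F
    (fun p q => (1 / 2 : F) * (p.1 * q.1) + skew p.2 q.2)
    (by intro p p' q; simp [skew]; ring)
    (by intro c p q; simp [skew]; ring)
    (by intro p q q'; simp [skew]; ring)
    (by intro c p q; simp [skew]; ring)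

/-- The projection of `K3` onto its even part. -/
def evenProj : K3 F →ₗ[F] K3 F := LinearMap.inl F F (Fin 2 → F) ∘ₗ LinearMap.fst F F (Fin 2 → F)

/-- The projection of `K3` onto its odd part. -/
def oddProj : K3 F →ₗ[F] K3 F := LinearMap.inr F F (Fin 2 → F) ∘ₗ LinearMap.snd F F (Fin 2 → F)

/-- The parity automorphism: `x ↦ (-1)^{|x|} x` on homogeneous elements. -/
def parity : K3 F →ₗ[F] K3 F := evenProj F - oddProj F

end K3

/-! ### Kac's ten-dimensional superalgebra -/

/-- `K10 F = F 1 ⊕ (K3 ⊗ K3)`: the pair `(α, s)` stands for `α 1 + s`. -/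
abbrev K10 (F : Type w) [Field F] : Type w := F × (K3 F ⊗[F] K3 F)

namespace K10

/-- The unity. -/
def one : K10 F := (1, 0)

/-- The element `x ⊗ y`. -/
def tmul {F : Type w} [Field F] (x y : K3 F) : K10 F := (0, x ⊗ₜ[F] y)

/-- The bilinear map with `(x ⊗ y, z ⊗ t) ↦ (-1)^{|y||z|} x z ⊗ y t` for homogeneous elements.
The even part of `z` contributes no sign, and its odd part contributes the sign `(-1)^{|y|}`. -/
def mulTensor : K3 F ⊗[F] K3 F →ₗ[F] K3 F ⊗[F] K3 F →ₗ[F] K3 F ⊗[F] K3 F :=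
  TensorProduct.map₂ ((K3.mul F).compl₂ (K3.evenProj F)) (K3.mul F) +
    TensorProduct.map₂ ((K3.mul F).compl₂ (K3.oddProj F)) (K3.mul F ∘ₗ K3.parity F)

/-- The bilinear form with `(x ⊗ y, z ⊗ t) ↦ (-1)^{|y||z|} (x | z) (y | t)` for homogeneous
elements. -/
def formTensor : K3 F ⊗[F] K3 F →ₗ[F] K3 F ⊗[F] K3 F →ₗ[F] F :=
  (TensorProduct.map₂ ((K3.form F).compl₂ (K3.evenProj F)) (K3.form F) +
    TensorProduct.map₂ ((K3.form F).compl₂ (K3.oddProj F)) (K3.form F ∘ₗ K3.parity F)).compr₂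
      (TensorProduct.lid F F).toLinearMap

/-- The product of `K10`: `1` is the unity, and
`(x ⊗ y) (z ⊗ t) = (-1)^{|y||z|} (x z ⊗ y t - (3/4) (x | z) (y | t) 1)`
for homogeneous `x, y, z, t` in `K3`. -/
def mul : K10 F →ₗ[F] K10 F →ₗ[F] K10 F :=
  LinearMap.mk₂ F
    (fun X Y => (X.1 * Y.1 - (3 / 4 : F) * formTensor F X.2 Y.2,
      X.1 • Y.2 + Y.1 • X.2 + mulTensor F X.2 Y.2))
    (by intro X X' Y; ext
        · simp; ring
        · simp [add_smul]; abel)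
    (by intro c X Y; ext
        · simp; ring
        · simp [mul_smul, smul_comm c])
    (by intro X Y Y'; ext
        · simp; ring
        · simp [add_smul]; abel)
    (by intro c X Y; ext
        · simp; ring
        · simp [mul_smul, smul_comm c])

theorem mul_tmul_tmul_of_left_even (x z t : K3 F) (r : F) :
    mul F (tmul x (r, 0)) (tmul z t) =
      tmul (K3.mul F x z) (K3.mul F (r, 0) t)
        - ((3 / 4 : F) * (K3.form F x z * K3.form F (r, 0) t)) • one F := by
  have hz : z = K3.evenProj F z + K3.oddProj F z := by ext <;> simp [K3.evenProj, K3.oddProj]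
  have hp : K3.parity F (r, 0) = (r, 0) := by
    ext <;> simp [K3.parity, K3.evenProj, K3.oddProj]
  ext
  · conv_rhs => rw [hz]
    simp [mul, tmul, one, formTensor, hp, -mul_eq_mul_left_iff]; ring
  · conv_rhs => rw [hz]
    simp [mul, tmul, one, mulTensor, hp, TensorProduct.add_tmul]

theorem mul_tmul_tmul_of_right_even (x y t : K3 F) (r : F) :
    mul F (tmul x y) (tmul (r, 0) t) =
      tmul (K3.mul F x (r, 0)) (K3.mul F y t)
        - ((3 / 4 : F) * (K3.form F x (r, 0) * K3.form F y t)) • one F := by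
  have h0 : K3.evenProj F (r, 0) = (r, 0) := by ext <;> simp [K3.evenProj]
  have h1 : K3.oddProj F (r, 0) = 0 := by ext <;> simp [K3.oddProj]
  ext <;> simp [mul, tmul, one, formTensor, mulTensor, h0, h1]

theorem mul_tmul_tmul_of_odd_odd (x t : K3 F) (y z : Fin 2 → F) :
    mul F (tmul x (K3.odd y)) (tmul (K3.odd z) t) =
      -(tmul (K3.mul F x (K3.odd z)) (K3.mul F (K3.odd y) t)
        - ((3 / 4 : F) * (K3.form F x (K3.odd z) * K3.form F (K3.odd y) t)) • one F) := by
  have h0 : K3.evenProj F (K3.odd z) = 0 := by ext <;> simp [K3.evenProj, K3.odd]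
  have h1 : K3.oddProj F (K3.odd z) = K3.odd z := by ext <;> simp [K3.oddProj, K3.odd]
  have hp : K3.parity F (K3.odd y) = -K3.odd y := by
    ext <;> simp [K3.parity, K3.evenProj, K3.oddProj, K3.odd]
  ext <;> simp [mul, tmul, one, formTensor, mulTensor, h0, h1, hp, TensorProduct.tmul_neg]

/-- The even part `F 1 ⊕ F (a ⊗ a) ⊕ (W ⊗ W)`. -/
def evenPart : Submodule F (K10 F) :=
  Submodule.span F ({one F, tmul (K3.a F) (K3.a F)} ∪
    {z | ∃ x y : Fin 2 → F, z = tmul (K3.odd x) (K3.odd y)})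

/-- The odd part `(W ⊗ a) ⊕ (a ⊗ W)`. -/
def oddPart : Submodule F (K10 F) :=
  Submodule.span F ({z | ∃ x : Fin 2 → F, z = tmul (K3.odd x) (K3.a F)} ∪
    {z | ∃ x : Fin 2 → F, z = tmul (K3.a F) (K3.odd x)})

/-- Automorphisms of the superalgebra: linear bijections that preserve the product and the
parity. -/
def IsAut {F : Type w} [Field F] (φ : K10 F ≃ₗ[F] K10 F) : Prop :=
  (∀ X Y, φ (mul F X Y) = mul F (φ X) (φ Y)) ∧
    (evenPart F).map φ.toLinearMap = evenPart F ∧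
    (oddPart F).map φ.toLinearMap = oddPart F

end K10

/-! ### Gradings on `K10` by abelian groups -/

/-- A `G`-grading on the superalgebra `K10`: a direct sum decomposition into subspaces indexed by
`G` with `A_g A_h ⊆ A_{gh}` and `A_g = (A_g ∩ A_even) ⊕ (A_g ∩ A_odd)`. -/
@[ext]
structure Grading (F : Type w) [Field F] (G : Type u) [CommGroup G] where
  comp : G → Submodule F (K10 F)
  independent : iSupIndep comp
  iSup_eq_top : ⨆ g, comp g = ⊤
  mul_mem : ∀ g h : G, ∀ X ∈ comp g, ∀ Y ∈ comp h, K10.mul F X Y ∈ comp (g * h)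
  super : ∀ g : G, comp g = (comp g ⊓ K10.evenPart F) ⊔ (comp g ⊓ K10.oddPart F)

namespace Grading

variable {F} {G : Type u} [CommGroup G] {H : Type v} [CommGroup H]

/-- The support: degrees of the nonzero homogeneous components. -/
def support (Γ : Grading F G) : Set G := {g | Γ.comp g ≠ ⊥}

/-- Isomorphism of two gradings by the same group. -/
def Iso (Γ Γ' : Grading F G) : Prop :=
  ∃ φ : K10 F ≃ₗ[F] K10 F, K10.IsAut φ ∧
    ∀ g, (Γ.comp g).map φ.toLinearMap = Γ'.comp g

/-- Equivalence of two gradings, by possibly different groups: some automorphism carries the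
nonzero homogeneous components of one to those of the other. -/
def Equivalent (Γ : Grading F G) (Γ' : Grading F H) : Prop :=
  ∃ φ : K10 F ≃ₗ[F] K10 F, K10.IsAut φ ∧
    ∀ g ∈ Γ.support, ∃ h ∈ Γ'.support, (Γ.comp g).map φ.toLinearMap = Γ'.comp h

/-- `Γ'` is a proper refinement of `Γ`: every component of `Γ'` lies in a component of `Γ`, and for
at least one nonzero component the inclusion is strict. -/
def IsProperRefinement (Γ' : Grading F H) (Γ : Grading F G) : Prop :=
  (∀ h, ∃ g, Γ'.comp h ≤ Γ.comp g) ∧ ∃ h ∈ Γ'.support, ∃ g, Γ'.comp h < Γ.comp g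

/-- `Γ¹(G; g₁, g₂)`: the grading is the one determined by
`deg (u ⊗ a) = g₁ = deg (v ⊗ a)⁻¹` and `deg (a ⊗ u) = g₂ = deg (a ⊗ v)⁻¹`. -/
def IsGamma1 (Γ : Grading F G) (g₁ g₂ : G) : Prop :=
  K10.tmul (K3.u F) (K3.a F) ∈ Γ.comp g₁ ∧
  K10.tmul (K3.v F) (K3.a F) ∈ Γ.comp g₁⁻¹ ∧
  K10.tmul (K3.a F) (K3.u F) ∈ Γ.comp g₂ ∧
  K10.tmul (K3.a F) (K3.v F) ∈ Γ.comp g₂⁻¹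

/-- `Γ²(G; g, h)`: the grading is the one determined by
`deg (u ⊗ a + a ⊗ u) = g = deg (v ⊗ a + a ⊗ v)⁻¹` and
`deg (u ⊗ a - a ⊗ u) = g h = deg (v ⊗ a - a ⊗ v)⁻¹`. -/
def IsGamma2 (Γ : Grading F G) (g h : G) : Prop :=
  K10.tmul (K3.u F) (K3.a F) + K10.tmul (K3.a F) (K3.u F) ∈ Γ.comp g ∧
  K10.tmul (K3.v F) (K3.a F) + K10.tmul (K3.a F) (K3.v F) ∈ Γ.comp g⁻¹ ∧
  K10.tmul (K3.u F) (K3.a F) - K10.tmul (K3.a F) (K3.u F) ∈ Γ.comp (g * h) ∧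
  K10.tmul (K3.v F) (K3.a F) - K10.tmul (K3.a F) (K3.v F) ∈ Γ.comp (g * h)⁻¹

end Grading

/-- A grading is fine if it has no proper refinement among the gradings by abelian groups (taken
in an arbitrary universe `v`). -/
def Grading.IsFine.{v', u', w'} {F : Type w'} [Field F] {G : Type u'} [CommGroup G]
    (Γ : Grading F G) : Prop :=
  ∀ (H : Type v') [CommGroup H] (Γ' : Grading F H), ¬ Γ'.IsProperRefinement Γ

end Kac

end

/-! Everything is read off from the odd part, identified with `W × W`, where `(x, y)` stands for `x
⊗ a + a ⊗ y`. Together with `1` it generates `K10`, and `1` always has degree `e`, so a grading is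
determined by the degrees of four homogeneous odd vectors forming a basis (`isGamma1_iff`,
`isGamma2_iff`).

Two structures on `W × W` are extracted from the triple product `(m n) p`: the symplectic form
`oddForm`, the orthogonal sum of the two copies of `(· | ·)`, and the involution `oddFlip`, `(x, y)
↦ (x, -y)`. Left multiplication by `m n` satisfies, after scaling, a quadratic equation whose linear
term carries `oddForm m n`. Comparing degrees shows that `oddForm` pairs degree `g` only with degree
`g⁻¹` (`oddForm_eq_zero`). Once the form is under control, another identity makes the flip of each
homogeneous vector homogeneous (`exists_oddFlip_mem`). If the flip preserves every component, both
copies of `W` are graded and have homogeneous symplectic bases. Otherwise it moves some homogeneous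
vector by a factor `h ≠ e`, and the same identities force `h² = e` and produce symplectic bases
adapted to the second type (`exists_symplectic_bases`). A pair of symplectic maps of `W` extends to
an automorphism of `K10` (`tensorEquiv_isAut`), which brings these bases to the standard ones.

Two invariants separate the isomorphism classes: the support of the odd part, and the product of the
degrees of a homogeneous basis (`detDegree`), equal to `e` for the first type and to `h` for the
second. The required isomorphisms come from the swap of the factors, a rotation of `W`, and a sign
on one factor.

For fineness, every grading of either type is a coarsening of the universal one, over `ℤ²` or `ℤ ×
ℤ/2`. In a universal grading the components outside degree `e` have dimension at most one, so a
refinement keeps the odd basis homogeneous. It is then again of the same type, and it cannot split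
the identity component. The identity components have dimensions 2 and 3, so the two are
inequivalent. -/

open scoped TensorProduct

noncomputable section

namespace Kac

/-! ### Coordinates and the multiplication table of `K10`. -/

section

variable {F : Type w} [Field F]

namespace K10

/-- The coordinates of an element of `K10` on the basis
`1, a ⊗ a, u ⊗ u, u ⊗ v, v ⊗ u, v ⊗ v, u ⊗ a, v ⊗ a, a ⊗ u, a ⊗ v`. -/
def coordFun (X : K10 F) : Fin 10 → F :=
  let f (p q : K3 F →ₗ[F] F) : F := TensorProduct.lid F F (TensorProduct.map p q X.2)
  let a := LinearMap.fst F F (Fin 2 → F)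
  let u := LinearMap.proj (R := F) (φ := fun _ : Fin 2 => F) 0 ∘ₗ LinearMap.snd F F (Fin 2 → F)
  let v := LinearMap.proj (R := F) (φ := fun _ : Fin 2 => F) 1 ∘ₗ LinearMap.snd F F (Fin 2 → F)
  ![X.1, f a a, f u u, f u v, f v u, f v v, f u a, f v a, f a u, f a v]

/-- The element `a ⊗ y₀ + u ⊗ y₁ + v ⊗ y₂` of `K3 ⊗ K3`. -/
def rows (y₀ y₁ y₂ : K3 F) : K3 F ⊗[F] K3 F :=
  K3.a F ⊗ₜ[F] y₀ + K3.u F ⊗ₜ[F] y₁ + K3.v F ⊗ₜ[F] y₂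

theorem mulTensor_rows (y₀ y₁ y₂ z₀ z₁ z₂ : K3 F) :
    mulTensor F (rows y₀ y₁ y₂) (rows z₀ z₁ z₂) =
      rows (K3.mul F y₀ z₀ + K3.mul F (K3.parity F y₁) z₂ - K3.mul F (K3.parity F y₂) z₁)
        ((1 / 2 : F) • (K3.mul F (K3.parity F y₀) z₁ + K3.mul F y₁ z₀))
        ((1 / 2 : F) • (K3.mul F (K3.parity F y₀) z₂ + K3.mul F y₂ z₀)) := by
  have e1 : K3.evenProj F (K3.a F) = K3.a F := by ext <;> simp [K3.evenProj, K3.a]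
  have e2 : K3.evenProj F (K3.u F) = 0 := by ext <;> simp [K3.evenProj, K3.u, K3.odd]
  have e3 : K3.evenProj F (K3.v F) = 0 := by ext <;> simp [K3.evenProj, K3.v, K3.odd]
  have o1 : K3.oddProj F (K3.a F) = 0 := by ext <;> simp [K3.oddProj, K3.a]
  have o2 : K3.oddProj F (K3.u F) = K3.u F := by ext <;> simp [K3.oddProj, K3.u, K3.odd]
  have o3 : K3.oddProj F (K3.v F) = K3.v F := by ext <;> simp [K3.oddProj, K3.v, K3.odd]
  have aa : K3.mul F (K3.a F) (K3.a F) = K3.a F := by ext <;> simp [K3.mul, K3.a, K3.skew]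
  have au : K3.mul F (K3.a F) (K3.u F) = (1 / 2 : F) • K3.u F := by
    ext <;> simp [K3.mul, K3.a, K3.u, K3.odd, K3.skew]
  have av : K3.mul F (K3.a F) (K3.v F) = (1 / 2 : F) • K3.v F := by
    ext <;> simp [K3.mul, K3.a, K3.v, K3.odd, K3.skew]
  have ua : K3.mul F (K3.u F) (K3.a F) = (1 / 2 : F) • K3.u F := by
    ext <;> simp [K3.mul, K3.a, K3.u, K3.odd, K3.skew]
  have va : K3.mul F (K3.v F) (K3.a F) = (1 / 2 : F) • K3.v F := by
    ext <;> simp [K3.mul, K3.a, K3.v, K3.odd, K3.skew]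
  have uu : K3.mul F (K3.u F) (K3.u F) = 0 := by ext <;> simp [K3.mul, K3.u, K3.odd, K3.skew]
  have vv : K3.mul F (K3.v F) (K3.v F) = 0 := by ext <;> simp [K3.mul, K3.v, K3.odd, K3.skew]
  have uv : K3.mul F (K3.u F) (K3.v F) = K3.a F := by
    ext <;> simp [K3.mul, K3.a, K3.u, K3.v, K3.odd, K3.skew]
  have vu : K3.mul F (K3.v F) (K3.u F) = - K3.a F := by
    ext <;> simp [K3.mul, K3.a, K3.u, K3.v, K3.odd, K3.skew]
  have hc (f g : K3 F →ₗ[F] K3 F) (x y z t : K3 F) :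
      TensorProduct.map₂ ((K3.mul F).compl₂ f) (K3.mul F ∘ₗ g) (x ⊗ₜ[F] y) (z ⊗ₜ[F] t)
        = K3.mul F x (f z) ⊗ₜ[F] K3.mul F (g y) t := rfl
  have hc' (f : K3 F →ₗ[F] K3 F) (x y z t : K3 F) :
      TensorProduct.map₂ ((K3.mul F).compl₂ f) (K3.mul F) (x ⊗ₜ[F] y) (z ⊗ₜ[F] t)
        = K3.mul F x (f z) ⊗ₜ[F] K3.mul F y t := rfl
  simp only [mulTensor, rows, LinearMap.add_apply, map_add, hc, hc', e1, e2, e3, o1, o2, o3, aa, au, av, ua, va, uu, vv, uv, vu,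
    map_zero, TensorProduct.zero_tmul, TensorProduct.neg_tmul,
    TensorProduct.tmul_add, TensorProduct.tmul_sub, TensorProduct.smul_tmul,
    TensorProduct.tmul_smul]
  module

theorem formTensor_rows (y₀ y₁ y₂ z₀ z₁ z₂ : K3 F) :
    formTensor F (rows y₀ y₁ y₂) (rows z₀ z₁ z₂) =
      (1 / 2 : F) * K3.form F y₀ z₀ + K3.form F (K3.parity F y₁) z₂
        - K3.form F (K3.parity F y₂) z₁ := by
  simp [formTensor, rows, K3.a, K3.u, K3.v, K3.odd, K3.evenProj, K3.oddProj, K3.form, K3.skew]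
  ring

/-- The element of `K10` with given coordinates. -/
def ofCoordFun (x : Fin 10 → F) : K10 F :=
  (x 0, rows (x 1, ![x 8, x 9]) (x 6, ![x 2, x 3]) (x 7, ![x 4, x 5]))

theorem rows_add (y₀ y₁ y₂ z₀ z₁ z₂ : K3 F) :
    rows (y₀ + z₀) (y₁ + z₁) (y₂ + z₂) = rows y₀ y₁ y₂ + rows z₀ z₁ z₂ := by
  simp only [rows, TensorProduct.tmul_add]
  abel

theorem rows_smul (c : F) (y₀ y₁ y₂ : K3 F) :
    rows (c • y₀) (c • y₁) (c • y₂) = c • rows y₀ y₁ y₂ := by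
  simp only [rows, TensorProduct.tmul_smul, smul_add]

theorem coordFun_ofCoordFun (x : Fin 10 → F) : coordFun (ofCoordFun x) = x := by
  ext i
  fin_cases i <;> simp [coordFun, ofCoordFun, rows, K3.a, K3.u, K3.v, K3.odd]

theorem ofCoordFun_add (x y : Fin 10 → F) : ofCoordFun (x + y) = ofCoordFun x + ofCoordFun y := by
  simp [ofCoordFun, ← rows_add]

theorem ofCoordFun_smul (c : F) (x : Fin 10 → F) : ofCoordFun (c • x) = c • ofCoordFun x := by
  simp [ofCoordFun, ← rows_smul]

theorem exists_rows (s : K3 F ⊗[F] K3 F) : ∃ y₀ y₁ y₂, s = rows y₀ y₁ y₂ := by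
  induction s with
  | zero => exact ⟨0, 0, 0, by simp [rows]⟩
  | add s t hs ht =>
    obtain ⟨y₀, y₁, y₂, rfl⟩ := hs
    obtain ⟨z₀, z₁, z₂, rfl⟩ := ht
    exact ⟨_, _, _, (rows_add ..).symm⟩
  | tmul x y =>
    refine ⟨x.1 • y, x.2 0 • y, x.2 1 • y, ?_⟩
    have hx : x = x.1 • K3.a F + x.2 0 • K3.u F + x.2 1 • K3.v F := by
      ext i
      · simp [K3.a, K3.u, K3.v, K3.odd]
      · fin_cases i <;> simp [K3.a, K3.u, K3.v, K3.odd]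
    conv_lhs => rw [hx]
    simp only [rows, TensorProduct.add_tmul, TensorProduct.tmul_smul, TensorProduct.smul_tmul]

theorem ofCoordFun_surjective (X : K10 F) : ∃ x, ofCoordFun x = X := by
  obtain ⟨r, s⟩ := X
  obtain ⟨y₀, y₁, y₂, rfl⟩ := exists_rows s
  refine ⟨![r, y₀.1, y₁.2 0, y₁.2 1, y₂.2 0, y₂.2 1, y₁.1, y₂.1, y₀.2 0, y₀.2 1], ?_⟩
  have h (y : K3 F) : (y.1, ![y.2 0, y.2 1]) = y := by
    ext i
    · rfl
    · fin_cases i <;> rfl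
  simp [ofCoordFun, h]

theorem ofCoordFun_coordFun (X : K10 F) : ofCoordFun (coordFun X) = X := by
  obtain ⟨x, rfl⟩ := ofCoordFun_surjective X
  rw [coordFun_ofCoordFun]

/-- The coordinates on `K10` as a linear equivalence. -/
def ofCoord (F : Type w) [Field F] : (Fin 10 → F) ≃ₗ[F] K10 F where
  toFun := ofCoordFun
  invFun := coordFun
  left_inv := coordFun_ofCoordFun
  right_inv := ofCoordFun_coordFun
  map_add' := ofCoordFun_add
  map_smul' := ofCoordFun_smul

/-- The multiplication table, to which later identities in `K10` reduce. `E` collects the products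
inside `W ⊗ W`, whose Koszul sign turns `a ⊗ a - 3/4` into its negative; `D` collects the products
inside `W ⊗ a` and inside `a ⊗ W`. -/
theorem ofCoord_mul (x y : Fin 10 → F) :
    mul F (ofCoord F x) (ofCoord F y) = ofCoord F (
      let E := (x 2 * y 5 + x 5 * y 2 - x 3 * y 4 - x 4 * y 3)
      let D := (x 6 * y 7 - x 7 * y 6 + x 8 * y 9 - x 9 * y 8)
      ![x 0 * y 0 - 3 / 16 * (x 1 * y 1) + 3 / 4 * E - 3 / 8 * D,
        x 0 * y 1 + x 1 * y 0 + x 1 * y 1 - E + D,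
        x 0 * y 2 + x 2 * y 0 + (x 1 * y 2 + x 2 * y 1) / 4 + (x 6 * y 8 - x 8 * y 6) / 4,
        x 0 * y 3 + x 3 * y 0 + (x 1 * y 3 + x 3 * y 1) / 4 + (x 6 * y 9 - x 9 * y 6) / 4,
        x 0 * y 4 + x 4 * y 0 + (x 1 * y 4 + x 4 * y 1) / 4 + (x 7 * y 8 - x 8 * y 7) / 4,
        x 0 * y 5 + x 5 * y 0 + (x 1 * y 5 + x 5 * y 1) / 4 + (x 7 * y 9 - x 9 * y 7) / 4,
        x 0 * y 6 + x 6 * y 0 + (x 1 * y 6 + x 6 * y 1) / 2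
          + (x 2 * y 9 - x 3 * y 8 + x 9 * y 2 - x 8 * y 3) / 2,
        x 0 * y 7 + x 7 * y 0 + (x 1 * y 7 + x 7 * y 1) / 2
          + (x 4 * y 9 - x 5 * y 8 + x 9 * y 4 - x 8 * y 5) / 2,
        x 0 * y 8 + x 8 * y 0 + (x 1 * y 8 + x 8 * y 1) / 2
          + (x 4 * y 6 - x 2 * y 7 + x 6 * y 4 - x 7 * y 2) / 2,
        x 0 * y 9 + x 9 * y 0 + (x 1 * y 9 + x 9 * y 1) / 2
          + (x 5 * y 6 - x 3 * y 7 + x 6 * y 5 - x 7 * y 3) / 2]) := by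
  -- The characteristic is arbitrary here. With every denominator written as a power of `2⁻¹`, the
  -- table becomes a polynomial identity in `2⁻¹`.
  have h4 : (4 : F)⁻¹ = 2⁻¹ * 2⁻¹ := by rw [← mul_inv]; norm_num
  have h8 : (8 : F)⁻¹ = 2⁻¹ * (2⁻¹ * 2⁻¹) := by simp only [← mul_inv]; norm_num
  have h16 : (16 : F)⁻¹ = 2⁻¹ * (2⁻¹ * (2⁻¹ * 2⁻¹)) := by simp only [← mul_inv]; norm_num
  change mul F (ofCoordFun x) (ofCoordFun y) = ofCoordFun _
  simp only [mul, ofCoordFun, LinearMap.mk₂_apply, mulTensor_rows, formTensor_rows, ← rows_smul,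
    ← rows_add]
  refine Prod.ext ?_ ?_
  · simp [K3.form, K3.parity, K3.evenProj, K3.oddProj, K3.skew, div_eq_mul_inv, h4, h8, h16]
    ring
  · dsimp only
    congr 1
    all_goals
      ext i
      · simp [K3.mul, K3.parity, K3.evenProj, K3.oddProj, K3.skew, div_eq_mul_inv, h4, h8, h16]
        ring
      · fin_cases i <;> simp [K3.mul, K3.parity, K3.evenProj, K3.oddProj, K3.skew, div_eq_mul_inv, h4, h8, h16] <;> ring

end K10

end

/-! ### Even and odd parts in coordinates; the odd part as `W × W`. -/

section

variable {F : Type w} [Field F]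

namespace K10

theorem one_eq_ofCoord : one F = ofCoord F ![1, 0, 0, 0, 0, 0, 0, 0, 0, 0] := by
  have h : ((0, ![0, 0]) : K3 F) = 0 := by simp
  ext
  · simp [one, ofCoord, ofCoordFun]
  · change 0 = rows (0, ![0, 0]) (0, ![0, 0]) (0, ![0, 0])
    simp only [h, rows, TensorProduct.tmul_zero, add_zero]

theorem tmul_eq_ofCoord (x y : K3 F) :
    tmul x y = ofCoord F ![0, x.1 * y.1, x.2 0 * y.2 0, x.2 0 * y.2 1, x.2 1 * y.2 0,
      x.2 1 * y.2 1, x.2 0 * y.1, x.2 1 * y.1, x.1 * y.2 0, x.1 * y.2 1] := by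
  apply (ofCoord F).symm.injective
  rw [LinearEquiv.symm_apply_apply]
  change coordFun (tmul x y) = _
  ext i
  fin_cases i <;> simp [coordFun, tmul]

theorem ofCoord_mem_evenPart {x : Fin 10 → F} :
    ofCoord F x ∈ evenPart F ↔ x 6 = 0 ∧ x 7 = 0 ∧ x 8 = 0 ∧ x 9 = 0 := by
  constructor
  · intro h
    let p : K10 F → Prop := fun X =>
      (ofCoord F).symm X 6 = 0 ∧ (ofCoord F).symm X 7 = 0 ∧ (ofCoord F).symm X 8 = 0 ∧
        (ofCoord F).symm X 9 = 0
    have : p (ofCoord F x) := by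
      refine Submodule.span_induction (p := fun X _ => p X) ?_ (by simp [p]) ?_ ?_ h
      · rintro X ((rfl | rfl) | ⟨y, z, rfl⟩)
        · simp [p, one_eq_ofCoord]
        · simp [p, tmul_eq_ofCoord, K3.a]
        · simp [p, tmul_eq_ofCoord, K3.odd]
      · intro X Y _ _ hX hY
        simp_all [p]
      · intro c X _ hX
        simp_all [p]
    simpa [p] using this
  · rintro ⟨h6, h7, h8, h9⟩
    have : ofCoord F x = x 0 • one F + x 1 • tmul (K3.a F) (K3.a F)
        + x 2 • tmul (K3.odd ![1, 0]) (K3.odd ![1, 0])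
        + x 3 • tmul (K3.odd ![1, 0]) (K3.odd ![0, 1])
        + x 4 • tmul (K3.odd ![0, 1]) (K3.odd ![1, 0])
        + x 5 • tmul (K3.odd ![0, 1]) (K3.odd ![0, 1]) := by
      simp only [one_eq_ofCoord, tmul_eq_ofCoord, ← map_smul, ← map_add]
      congr 1
      ext i
      fin_cases i <;> simp [K3.a, K3.odd, *]
    rw [this]
    refine add_mem (add_mem (add_mem (add_mem (add_mem ?_ ?_) ?_) ?_) ?_) ?_ <;>
      refine Submodule.smul_mem _ _ (Submodule.subset_span ?_)
    · simp
    · simp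
    all_goals exact Or.inr ⟨_, _, rfl⟩

/-- The parametrization of the odd part by `W × W`. -/
def oddMap (F : Type w) [Field F] : (Fin 2 → F) × (Fin 2 → F) →ₗ[F] K10 F :=
  ofCoord F ∘ₗ
    { toFun := fun m => ![0, 0, 0, 0, 0, 0, m.1 0, m.1 1, m.2 0, m.2 1]
      map_add' := by intro m n; simp
      map_smul' := by intro c m; simp }

theorem oddMap_apply (m : (Fin 2 → F) × (Fin 2 → F)) :
    oddMap F m = ofCoord F ![0, 0, 0, 0, 0, 0, m.1 0, m.1 1, m.2 0, m.2 1] := rfl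

theorem oddMap_eq (m : (Fin 2 → F) × (Fin 2 → F)) :
    oddMap F m = tmul (K3.odd m.1) (K3.a F) + tmul (K3.a F) (K3.odd m.2) := by
  rw [oddMap_apply, tmul_eq_ofCoord, tmul_eq_ofCoord, ← map_add]
  simp [K3.odd, K3.a]

theorem oddMap_injective : Function.Injective (oddMap F) := by
  intro m n h
  have h := (ofCoord F).injective h
  simp only [LinearMap.coe_mk, AddHom.coe_mk] at h
  have h6 := congrFun h 6
  have h7 := congrFun h 7
  have h8 := congrFun h 8
  have h9 := congrFun h 9
  simp at h6 h7 h8 h9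
  ext i <;> fin_cases i <;> simpa

theorem oddMap_mem (m : (Fin 2 → F) × (Fin 2 → F)) : oddMap F m ∈ oddPart F := by
  rw [oddMap_eq]
  exact add_mem (Submodule.subset_span (Or.inl ⟨_, rfl⟩)) (Submodule.subset_span (Or.inr ⟨_, rfl⟩))

theorem mem_oddPart {X : K10 F} : X ∈ oddPart F ↔ ∃ m, oddMap F m = X := by
  constructor
  · intro h
    suffices oddPart F ≤ LinearMap.range (oddMap F) from this h
    refine Submodule.span_le.2 ?_
    rintro X (⟨x, rfl⟩ | ⟨x, rfl⟩)
    · refine ⟨(x, 0), ?_⟩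
      rw [oddMap_apply, tmul_eq_ofCoord]
      simp [K3.odd, K3.a]
    · refine ⟨(0, x), ?_⟩
      rw [oddMap_apply, tmul_eq_ofCoord]
      simp [K3.odd, K3.a]
  · rintro ⟨m, rfl⟩
    exact oddMap_mem m

theorem ofCoord_mem_oddPart {x : Fin 10 → F} :
    ofCoord F x ∈ oddPart F ↔ x 0 = 0 ∧ x 1 = 0 ∧ x 2 = 0 ∧ x 3 = 0 ∧ x 4 = 0 ∧ x 5 = 0 := by
  rw [mem_oddPart]
  constructor
  · rintro ⟨m, hm⟩
    rw [oddMap_apply] at hm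
    rw [← (ofCoord F).injective hm]
    simp
  · rintro ⟨h0, h1, h2, h3, h4, h5⟩
    refine ⟨(![x 6, x 7], ![x 8, x 9]), ?_⟩
    rw [oddMap_apply]
    congr 1
    ext i
    fin_cases i <;> simp [*]

/-! ### Automorphisms: pairs of symplectic maps, and the swap of the tensor factors. -/

theorem unit_mul (X : K10 F) : mul F (one F) X = X := by
  ext <;> simp [mul, one]

theorem mul_unit (X : K10 F) : mul F X (one F) = X := by
  ext <;> simp [mul, one]

theorem isAut_of_le {φ : K10 F ≃ₗ[F] K10 F} (hmul : ∀ X Y, φ (mul F X Y) = mul F (φ X) (φ Y))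
    (he : ∀ X ∈ evenPart F, φ X ∈ evenPart F) (ho : ∀ X ∈ oddPart F, φ X ∈ oddPart F) :
    IsAut φ := by
  refine ⟨hmul, ?_, ?_⟩
  · refine Submodule.eq_of_le_of_finrank_eq ?_ (LinearEquiv.finrank_map_eq φ _)
    rintro _ ⟨X, hX, rfl⟩
    exact he X hX
  · refine Submodule.eq_of_le_of_finrank_eq ?_ (LinearEquiv.finrank_map_eq φ _)
    rintro _ ⟨X, hX, rfl⟩
    exact ho X hX

theorem IsAut.apply_mem_evenPart {φ : K10 F ≃ₗ[F] K10 F} (h : IsAut φ) {X : K10 F}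
    (hX : X ∈ evenPart F) : φ X ∈ evenPart F :=
  h.2.1 ▸ Submodule.mem_map_of_mem hX

theorem IsAut.apply_mem_oddPart {φ : K10 F ≃ₗ[F] K10 F} (h : IsAut φ) {X : K10 F}
    (hX : X ∈ oddPart F) : φ X ∈ oddPart F :=
  h.2.2 ▸ Submodule.mem_map_of_mem hX

theorem IsAut.refl : IsAut (LinearEquiv.refl F (K10 F)) :=
  isAut_of_le (fun _ _ => rfl) (fun _ h => h) (fun _ h => h)

theorem IsAut.trans {φ ψ : K10 F ≃ₗ[F] K10 F} (h : IsAut φ) (h' : IsAut ψ) :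
    IsAut (φ.trans ψ) :=
  isAut_of_le (fun X Y => by simp [h.1, h'.1])
    (fun _ hX => h'.apply_mem_evenPart (h.apply_mem_evenPart hX))
    (fun _ hX => h'.apply_mem_oddPart (h.apply_mem_oddPart hX))

theorem IsAut.symm {φ : K10 F ≃ₗ[F] K10 F} (h : IsAut φ) : IsAut φ.symm := by
  refine isAut_of_le (fun X Y => φ.injective (by simp [h.1])) (fun X hX => ?_) (fun X hX => ?_)
  · rw [← h.2.1] at hX
    obtain ⟨Y, hY, rfl⟩ := hX
    simpa using hY
  · rw [← h.2.2] at hX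
    obtain ⟨Y, hY, rfl⟩ := hX
    simpa using hY

theorem IsAut.map_one {φ : K10 F ≃ₗ[F] K10 F} (h : IsAut φ) : φ (one F) = one F := by
  obtain ⟨X, hX⟩ := φ.surjective (one F)
  have h1 := h.1 (one F) X
  rw [unit_mul, hX, mul_unit] at h1
  exact h1.symm

/-- The linear automorphism of `K3` that fixes `a` and acts on `W` by the given map. -/
def K3equiv (A : (Fin 2 → F) ≃ₗ[F] (Fin 2 → F)) : K3 F ≃ₗ[F] K3 F :=
  (LinearEquiv.refl F F).prodCongr A

/-- The linear automorphism of `K10` induced by a pair of linear automorphisms of `W`. -/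
def tensorEquiv (A B : (Fin 2 → F) ≃ₗ[F] (Fin 2 → F)) : K10 F ≃ₗ[F] K10 F :=
  (LinearEquiv.refl F F).prodCongr (TensorProduct.congr (K3equiv A) (K3equiv B))

theorem tensorEquiv_tmul (A B : (Fin 2 → F) ≃ₗ[F] (Fin 2 → F)) (x y : K3 F) :
    tensorEquiv A B (tmul x y) = tmul (x.1, A x.2) (y.1, B y.2) := by
  ext <;> simp [tensorEquiv, tmul, K3equiv]

theorem tensorEquiv_one (A B : (Fin 2 → F) ≃ₗ[F] (Fin 2 → F)) :
    tensorEquiv A B (one F) = one F := by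
  ext <;> simp [tensorEquiv, one]

theorem tensorEquiv_oddMap (A B : (Fin 2 → F) ≃ₗ[F] (Fin 2 → F))
    (m : (Fin 2 → F) × (Fin 2 → F)) :
    tensorEquiv A B (oddMap F m) = oddMap F (A m.1, B m.2) := by
  simp [oddMap_eq, tensorEquiv_tmul, K3.odd, K3.a]

/-- A map of `W` preserving the skew form extends, fixing `a`, to a map of `K3` that preserves
product, form and parity. These are the only ingredients of the product of `K10`, so `SL(W) × SL(W)`
acts on `K10`. -/
theorem tensorEquiv_isAut {A B : (Fin 2 → F) ≃ₗ[F] (Fin 2 → F)}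
    (hA : ∀ x y, K3.skew (A x) (A y) = K3.skew x y)
    (hB : ∀ x y, K3.skew (B x) (B y) = K3.skew x y) : IsAut (tensorEquiv A B) := by
  have hm {A : (Fin 2 → F) ≃ₗ[F] (Fin 2 → F)} (hA : ∀ x y, K3.skew (A x) (A y) = K3.skew x y)
      (x y : K3 F) : K3.mul F (K3equiv A x) (K3equiv A y) = K3equiv A (K3.mul F x y) := by
    ext <;> simp [K3.mul, K3equiv, hA]
  have hf {A : (Fin 2 → F) ≃ₗ[F] (Fin 2 → F)} (hA : ∀ x y, K3.skew (A x) (A y) = K3.skew x y)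
      (x y : K3 F) : K3.form F (K3equiv A x) (K3equiv A y) = K3.form F x y := by
    simp [K3.form, K3equiv, hA]
  have he (A : (Fin 2 → F) ≃ₗ[F] (Fin 2 → F)) (x : K3 F) :
      K3.evenProj F (K3equiv A x) = K3equiv A (K3.evenProj F x) := by
    ext <;> simp [K3.evenProj, K3equiv]
  have ho (A : (Fin 2 → F) ≃ₗ[F] (Fin 2 → F)) (x : K3 F) :
      K3.oddProj F (K3equiv A x) = K3equiv A (K3.oddProj F x) := by
    ext <;> simp [K3.oddProj, K3equiv]
  have hp (A : (Fin 2 → F) ≃ₗ[F] (Fin 2 → F)) (x : K3 F) :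
      K3.parity F (K3equiv A x) = K3equiv A (K3.parity F x) := by
    simp [K3.parity, he, ho]
  have hmT (s t : K3 F ⊗[F] K3 F) : mulTensor F (TensorProduct.congr (K3equiv A) (K3equiv B) s)
      (TensorProduct.congr (K3equiv A) (K3equiv B) t)
        = TensorProduct.congr (K3equiv A) (K3equiv B) (mulTensor F s t) := by
    induction s with
    | zero => simp
    | add s s' hs hs' => simp only [map_add, LinearMap.add_apply, hs, hs']
    | tmul x y =>
      induction t with
      | zero => simp
      | add t t' ht ht' => simp only [map_add, ht, ht']
      | tmul z t => simp [mulTensor, he, ho, hp, hm hA, hm hB]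
  have hfT (s t : K3 F ⊗[F] K3 F) : formTensor F (TensorProduct.congr (K3equiv A) (K3equiv B) s)
      (TensorProduct.congr (K3equiv A) (K3equiv B) t) = formTensor F s t := by
    induction s with
    | zero => simp
    | add s s' hs hs' => simp only [map_add, LinearMap.add_apply, hs, hs']
    | tmul x y =>
      induction t with
      | zero => simp
      | add t t' ht ht' => simp only [map_add, ht, ht']
      | tmul z t => simp [formTensor, he, ho, hp, hf hA, hf hB]
  refine isAut_of_le ?_ ?_ ?_
  · intro X Y
    ext
    · simp [tensorEquiv, mul, hfT]
    · simp [tensorEquiv, mul, hmT]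
  · intro X hX
    suffices evenPart F ≤ (evenPart F).comap (tensorEquiv A B).toLinearMap from this hX
    refine Submodule.span_le.2 ?_
    rintro X ((rfl | rfl) | ⟨y, z, rfl⟩) <;> refine Submodule.subset_span ?_
    · exact Or.inl (Or.inl (tensorEquiv_one A B))
    · refine Or.inl (Or.inr ?_)
      simp [tensorEquiv_tmul, K3.a]
    · refine Or.inr ⟨A y, B z, ?_⟩
      simp [tensorEquiv_tmul, K3.odd]
  · intro X hX
    obtain ⟨m, rfl⟩ := mem_oddPart.1 hX
    rw [tensorEquiv_oddMap]
    exact oddMap_mem _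

/-- The linear automorphism of `W` with given images of the symplectic basis. -/
def symplecticEquiv (x y : Fin 2 → F) (h : K3.skew x y = 1) : (Fin 2 → F) ≃ₗ[F] (Fin 2 → F) where
  toFun := fun z => z 0 • x + z 1 • y
  map_add' := by intro z z'; simp only [Pi.add_apply]; module
  map_smul' := by intro c z; simp only [Pi.smul_apply, smul_eq_mul, RingHom.id_apply]; module
  invFun := fun z => ![K3.skew z y, K3.skew x z]
  left_inv := by
    intro z
    simp only [K3.skew] at h
    ext i
    fin_cases i
    · simp [K3.skew]; linear_combination z 0 * h
    · simp [K3.skew]; linear_combination z 1 * h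
  right_inv := by
    intro z
    simp only [K3.skew] at h
    ext i
    fin_cases i
    · simp [K3.skew]; linear_combination z 0 * h
    · simp [K3.skew]; linear_combination z 1 * h

theorem symplecticEquiv_apply (x y : Fin 2 → F) (h : K3.skew x y = 1) (z : Fin 2 → F) :
    symplecticEquiv x y h z = z 0 • x + z 1 • y := rfl

theorem skew_symplecticEquiv (x y : Fin 2 → F) (h : K3.skew x y = 1) (z t : Fin 2 → F) :
    K3.skew (symplecticEquiv x y h z) (symplecticEquiv x y h t) = K3.skew z t := by
  rw [symplecticEquiv_apply, symplecticEquiv_apply]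
  simp only [K3.skew, Pi.add_apply, Pi.smul_apply, smul_eq_mul] at h ⊢
  linear_combination (z 0 * t 1 - z 1 * t 0) * h

/-- The coordinate form of the automorphism `x ⊗ y ↦ (-1)^{|x||y|} y ⊗ x` of `K10`. -/
def swapCoord (F : Type w) [Field F] : (Fin 10 → F) ≃ₗ[F] (Fin 10 → F) where
  toFun := fun x => ![x 0, x 1, -x 2, -x 4, -x 3, -x 5, x 8, x 9, x 6, x 7]
  invFun := fun x => ![x 0, x 1, -x 2, -x 4, -x 3, -x 5, x 8, x 9, x 6, x 7]
  left_inv := by intro x; ext i; fin_cases i <;> simp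
  right_inv := by intro x; ext i; fin_cases i <;> simp
  map_add' := by intro x y; ext i; fin_cases i <;> simp <;> ring
  map_smul' := by intro c x; ext i; fin_cases i <;> simp

/-- The automorphism `x ⊗ y ↦ (-1)^{|x||y|} y ⊗ x` of `K10`. -/
def swap (F : Type w) [Field F] : K10 F ≃ₗ[F] K10 F :=
  ((ofCoord F).symm.trans (swapCoord F)).trans (ofCoord F)

theorem swap_ofCoord (x : Fin 10 → F) : swap F (ofCoord F x)
    = ofCoord F ![x 0, x 1, -x 2, -x 4, -x 3, -x 5, x 8, x 9, x 6, x 7] := by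
  simp [swap, swapCoord]

theorem swap_oddMap (m : (Fin 2 → F) × (Fin 2 → F)) : swap F (oddMap F m) = oddMap F m.swap := by
  rw [oddMap_apply, swap_ofCoord, oddMap_apply]
  simp

theorem swap_isAut : IsAut (swap F) := by
  refine isAut_of_le ?_ ?_ ?_
  · intro X Y
    obtain ⟨x, rfl⟩ := (ofCoord F).surjective X
    obtain ⟨y, rfl⟩ := (ofCoord F).surjective Y
    rw [ofCoord_mul, swap_ofCoord, swap_ofCoord, swap_ofCoord, ofCoord_mul]
    congr 1
    ext i
    fin_cases i <;> simp <;> ring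
  · intro X hX
    obtain ⟨x, rfl⟩ := (ofCoord F).surjective X
    rw [swap_ofCoord, ofCoord_mem_evenPart]
    have := ofCoord_mem_evenPart.1 hX
    simp [this]
  · intro X hX
    obtain ⟨m, rfl⟩ := mem_oddPart.1 hX
    rw [swap_oddMap]
    exact oddMap_mem _

end K10

end

/-! ### Decompositions, and gradings given by a homogeneous basis. -/

section

section Decomposition

variable {F : Type w} [Field F] {V : Type*} [AddCommGroup V] [Module F V] {ι : Type*}
  {A B : ι → Submodule F V}

/-- A family of subspaces that spans and is contained componentwise in an independent family is
equal to it. -/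
theorem eq_of_le_of_iSupIndep (hA : iSupIndep A) (hB : ⨆ i, B i = ⊤) (h : ∀ i, B i ≤ A i) :
    B = A := by
  funext i
  refine le_antisymm (h i) fun x hx => ?_
  have hx' : x ∈ B i ⊔ ⨆ (j) (_ : j ≠ i), B j := by
    rw [← iSup_split_single, hB]
    trivial
  obtain ⟨y, hy, z, hz, rfl⟩ := Submodule.mem_sup.1 hx'
  have hzA : z ∈ A i := by simpa using sub_mem hx (h i hy)
  have hz' : z ∈ ⨆ (j) (_ : j ≠ i), A j :=
    (iSup₂_mono fun j _ => h j : (⨆ (j) (_ : j ≠ i), B j) ≤ ⨆ (j) (_ : j ≠ i), A j) hz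
  have := Submodule.disjoint_def.1 (hA i) z hzA hz'
  simpa [this] using hy

theorem mem_eq_zero_of_ne (hA : iSupIndep A) {i j : ι} (hij : i ≠ j) {x : V} (hi : x ∈ A i)
    (hj : x ∈ A j) : x = 0 :=
  Submodule.disjoint_def.1 (hA.pairwiseDisjoint hij) x hi hj

/-- Every element of the whole space satisfies an additive property that holds on components. -/
theorem induction_on_components (hA : ⨆ i, A i = ⊤) {p : V → Prop} (x : V)
    (mem : ∀ i, ∀ x ∈ A i, p x) (zero : p 0) (add : ∀ x y, p x → p y → p (x + y)) : p x :=
  Submodule.iSup_induction A (motive := p) (hA ▸ Submodule.mem_top : x ∈ ⨆ i, A i) mem zero add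

/-- The projections onto the components of a decomposition. -/
theorem exists_component_projection (hA : iSupIndep A) (hA' : ⨆ i, A i = ⊤) (i : ι) :
    ∃ π : V →ₗ[F] V, (∀ x ∈ A i, π x = x) ∧ ∀ j ≠ i, ∀ x ∈ A j, π x = 0 := by
  have hc : IsCompl (A i) (⨆ (j) (_ : j ≠ i), A j) :=
    ⟨hA i, codisjoint_iff.2 (by rw [← iSup_split_single, hA'])⟩
  refine ⟨Submodule.projection _ _ hc, fun x hx => ?_, fun j hj x hx => ?_⟩
  · exact Submodule.projection_apply_left hc ⟨x, hx⟩
  · exact (Submodule.projection_apply_eq_zero_iff hc).2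
      (Submodule.mem_iSup_of_mem j (Submodule.mem_iSup_of_mem hj hx))

end Decomposition

section Coordinates

variable {F : Type w} [Field F] {D : Type*}

/-- The subspace of `K10` spanned by the elements of degree `g` of a basis with degrees `d`; the
basis is given by its coordinate isomorphism `e`. -/
def coordComp (e : (Fin 10 → F) ≃ₗ[F] K10 F) (d : Fin 10 → D) (g : D) : Submodule F (K10 F) where
  carrier := {X | ∀ i, d i ≠ g → e.symm X i = 0}
  zero_mem' := by intro i _; simp
  add_mem' := by intro X Y hX hY i hi; simp [hX i hi, hY i hi]
  smul_mem' := by intro c X hX i hi; simp [hX i hi]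

theorem basis_mem_coordComp (e : (Fin 10 → F) ≃ₗ[F] K10 F) (d : Fin 10 → D) (i : Fin 10) :
    e (Pi.single i 1) ∈ coordComp e d (d i) := by
  intro j hj
  have : j ≠ i := fun h => hj (by rw [h])
  simp [this]

theorem eq_sum_basis (e : (Fin 10 → F) ≃ₗ[F] K10 F) (X : K10 F) :
    X = ∑ i, e.symm X i • e (Pi.single i 1) := by
  simp only [← map_smul, ← map_sum]
  rw [← LinearEquiv.symm_apply_eq]
  ext j
  simp [Finset.sum_apply, Pi.single_apply]

theorem iSup_coordComp (e : (Fin 10 → F) ≃ₗ[F] K10 F) (d : Fin 10 → D) :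
    ⨆ g, coordComp e d g = ⊤ := by
  refine eq_top_iff.2 fun X _ => ?_
  rw [eq_sum_basis e X]
  exact sum_mem fun i _ => Submodule.smul_mem _ _
    (Submodule.mem_iSup_of_mem _ (basis_mem_coordComp e d i))

theorem iSupIndep_coordComp (e : (Fin 10 → F) ≃ₗ[F] K10 F) (d : Fin 10 → D) :
    iSupIndep (coordComp e d) := by
  intro g
  rw [Submodule.disjoint_def]
  intro X hX hX'
  have hle : (⨆ (j) (_ : j ≠ g), coordComp e d j) ≤
      { carrier := {X | ∀ i, d i = g → e.symm X i = 0}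
        zero_mem' := by intro i _; simp
        add_mem' := by intro X Y hX hY i hi; simp [hX i hi, hY i hi]
        smul_mem' := by intro c X hX i hi; simp [hX i hi] } := by
    refine iSup₂_le fun j hj Y hY i hi => hY i ?_
    rw [hi]
    exact hj.symm
  have hX' := hle hX'
  rw [← LinearEquiv.map_eq_zero_iff e.symm]
  ext i
  by_cases hi : d i = g
  · exact hX' i hi
  · exact hX i hi

open scoped Classical in
theorem finrank_coordComp (e : (Fin 10 → F) ≃ₗ[F] K10 F) (d : Fin 10 → D) (g : D) :
    Module.finrank F (coordComp e d g) = (Finset.univ.filter fun i => d i = g).card := by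
  have hli : LinearIndependent F fun i : {i // d i = g} => e (Pi.single i.1 (1 : F)) := by
    have h := ((Pi.basisFun F (Fin 10)).map e).linearIndependent.comp
      (fun i : {i // d i = g} => i.1) Subtype.val_injective
    convert h with i
    simp
  have hspan : coordComp e d g
      = Submodule.span F (Set.range fun i : {i // d i = g} => e (Pi.single i.1 (1 : F))) := by
    refine le_antisymm (fun X hX => ?_) (Submodule.span_le.2 ?_)
    · rw [eq_sum_basis e X]
      refine sum_mem fun i _ => ?_
      by_cases hi : d i = g
      · exact Submodule.smul_mem _ _ (Submodule.subset_span ⟨⟨i, hi⟩, rfl⟩)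
      · rw [hX i hi, zero_smul]
        exact zero_mem _
    · rintro _ ⟨⟨i, rfl⟩, rfl⟩
      exact basis_mem_coordComp e d i
  rw [hspan, finrank_span_eq_card hli, Fintype.card_subtype]

end Coordinates

variable {F : Type w} [Field F] {G : Type u} [CommGroup G]

namespace Grading

open K10

/-- The component `π 1` of the unit in degree `e` is itself a left unit: for homogeneous `X` of
degree `k`, the degree-`k` part of `Y X` is `(π Y) X`. Taking `Y = 1` gives `(π 1) X = X`, hence `π
1 = 1`. -/
theorem one_mem (Γ : Grading F G) : one F ∈ Γ.comp 1 := by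
  obtain ⟨π, h1, h0⟩ := exists_component_projection Γ.independent Γ.iSup_eq_top 1
  have key (k : G) (X : K10 F) (hX : X ∈ Γ.comp k) : mul F (π (one F)) X = X := by
    obtain ⟨ρ, hρ1, hρ0⟩ := exists_component_projection Γ.independent Γ.iSup_eq_top k
    have (Y : K10 F) : ρ (mul F Y X) = mul F (π Y) X := by
      refine induction_on_components Γ.iSup_eq_top
        (p := fun Y => ρ (mul F Y X) = mul F (π Y) X) Y (fun g Y hY => ?_) (by simp) ?_
      · have hm := Γ.mul_mem _ _ Y hY X hX
        by_cases hg : g = 1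
        · subst hg
          rw [one_mul] at hm
          rw [h1 Y hY, hρ1 _ hm]
        · rw [h0 g hg Y hY, hρ0 (g * k) (by simpa using hg) _ hm]
          simp
      · intro Y Z hY hZ
        simp [hY, hZ]
    rw [← this, unit_mul, hρ1 X hX]
  have : π (one F) = one F := by
    rw [← mul_unit (π (one F))]
    exact induction_on_components Γ.iSup_eq_top (p := fun X => mul F (π (one F)) X = X) (one F)
      key (by simp) (fun X Y hX hY => by rw [map_add, hX, hY])
  have hmem (X : K10 F) : π X ∈ Γ.comp 1 := by
    refine induction_on_components Γ.iSup_eq_top (p := fun X => π X ∈ Γ.comp 1) X (fun g X hX => ?_) (by simp) ?_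
    · by_cases hg : g = 1
      · subst hg
        rwa [h1 X hX]
      · rw [h0 g hg X hX]
        exact zero_mem _
    · intro X Y hX hY
      rw [map_add]
      exact add_mem hX hY
  exact this ▸ hmem (one F)

end Grading

/-- The grading for which a given basis of `K10` is homogeneous of given degrees. -/
def gradingOfCoord (e : (Fin 10 → F) ≃ₗ[F] K10 F) (d : Fin 10 → G)
    (hmul : ∀ (x y : Fin 10 → F) (k : Fin 10), (∀ i j, d i * d j = d k → x i * y j = 0) →
      e.symm (K10.mul F (e x) (e y)) k = 0)
    (hsuper : ∀ i, e (Pi.single i 1) ∈ K10.evenPart F ∨ e (Pi.single i 1) ∈ K10.oddPart F) :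
    Grading F G where
  comp := coordComp e d
  independent := iSupIndep_coordComp e d
  iSup_eq_top := iSup_coordComp e d
  mul_mem := by
    intro g h X hX Y hY k hk
    have := hmul (e.symm X) (e.symm Y) k fun i j hij => by
      by_cases hi : d i = g
      · have : d j ≠ h := by
          rintro rfl
          exact hk (by rw [← hij, hi])
        rw [hY j this, mul_zero]
      · rw [hX i hi, zero_mul]
    simpa using this
  super := by
    intro g
    refine le_antisymm (fun X hX => ?_) (sup_le inf_le_left inf_le_left)
    rw [eq_sum_basis e X]
    refine sum_mem fun i _ => ?_
    by_cases hi : d i = g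
    · refine Submodule.smul_mem _ _ ?_
      have hm : e (Pi.single i 1) ∈ coordComp e d g := hi ▸ basis_mem_coordComp e d i
      rcases hsuper i with h | h
      · exact Submodule.mem_sup_left ⟨hm, h⟩
      · exact Submodule.mem_sup_right ⟨hm, h⟩
    · rw [hX i hi, zero_smul]
      exact zero_mem _

/-- The spans of basis vectors of equal degree already fill the whole space, so the components of
`Γ` have no room to be larger. -/
theorem Grading.comp_eq_coordComp (Γ : Grading F G) (e : (Fin 10 → F) ≃ₗ[F] K10 F)
    (d : Fin 10 → G) (h : ∀ i, e (Pi.single i 1) ∈ Γ.comp (d i)) : Γ.comp = coordComp e d := by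
  refine (eq_of_le_of_iSupIndep Γ.independent (iSup_coordComp e d) fun g X hX => ?_).symm
  rw [eq_sum_basis e X]
  refine sum_mem fun i _ => ?_
  by_cases hi : d i = g
  · exact Submodule.smul_mem _ _ (hi ▸ h i)
  · rw [hX i hi, zero_smul]
    exact zero_mem _

end

/-! ### Construction of the gradings of the two types. -/

section

variable {F : Type w} [Field F] {G : Type u} [CommGroup G]

open K10

/-- The degrees of the basis `1, a ⊗ a, u ⊗ u, u ⊗ v, v ⊗ u, v ⊗ v, u ⊗ a, v ⊗ a, a ⊗ u, a ⊗ v`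
in the gradings of the first type. -/
def degree1 (g₁ g₂ : G) (i : Fin 10) : G :=
  g₁ ^ (![0, 0, 1, 1, -1, -1, 1, -1, 0, 0] i : ℤ) * g₂ ^ (![0, 0, 1, -1, 1, -1, 0, 0, 1, -1] i : ℤ)

/-- Degrees are compared through integer weights, so that compatibility with the multiplication
table becomes a finite computation independent of `G`. Coincidences among degrees in a particular
`G` do no harm. -/
theorem degree1_mul {g₁ g₂ : G} {i j k : Fin 10}
    (h : (![0, 0, 1, 1, -1, -1, 1, -1, 0, 0] i + ![0, 0, 1, 1, -1, -1, 1, -1, 0, 0] j : ℤ)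
        = ![0, 0, 1, 1, -1, -1, 1, -1, 0, 0] k ∧
      (![0, 0, 1, -1, 1, -1, 0, 0, 1, -1] i + ![0, 0, 1, -1, 1, -1, 0, 0, 1, -1] j : ℤ)
        = ![0, 0, 1, -1, 1, -1, 0, 0, 1, -1] k) :
    degree1 g₁ g₂ i * degree1 g₁ g₂ j = degree1 g₁ g₂ k := by
  simp only [degree1]
  rw [← h.1, ← h.2, zpow_add, zpow_add, mul_mul_mul_comm]

/-- The degrees of the basis `1, a ⊗ a, u ⊗ u, u ⊗ v - v ⊗ u, u ⊗ v + v ⊗ u, v ⊗ v,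
u ⊗ a + a ⊗ u, v ⊗ a + a ⊗ v, u ⊗ a - a ⊗ u, v ⊗ a - a ⊗ v` in the gradings of the second type. -/
def degree2 (g h : G) (i : Fin 10) : G :=
  g ^ (![0, 0, 2, 0, 0, -2, 1, -1, 1, -1] i : ℤ) * h ^ (![0, 0, 1, 0, 1, 1, 0, 0, 1, 1] i : ℤ)

theorem degree2_mul {g h : G} (hh : h ^ 2 = 1) {i j k : Fin 10}
    (H : (![0, 0, 2, 0, 0, -2, 1, -1, 1, -1] i + ![0, 0, 2, 0, 0, -2, 1, -1, 1, -1] j : ℤ)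
        = ![0, 0, 2, 0, 0, -2, 1, -1, 1, -1] k ∧
      (2 : ℤ) ∣ ![0, 0, 1, 0, 1, 1, 0, 0, 1, 1] i + ![0, 0, 1, 0, 1, 1, 0, 0, 1, 1] j
        - ![0, 0, 1, 0, 1, 1, 0, 0, 1, 1] k) :
    degree2 g h i * degree2 g h j = degree2 g h k := by
  simp only [degree2]
  obtain ⟨h1, c, hc⟩ := H
  rw [mul_mul_mul_comm, ← zpow_add, ← zpow_add, h1, ← sub_add_cancel
    (![0, 0, 1, 0, 1, 1, 0, 0, 1, 1] i + ![0, 0, 1, 0, 1, 1, 0, 0, 1, 1] j : ℤ)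
    (![0, 0, 1, 0, 1, 1, 0, 0, 1, 1] k), hc, zpow_add, zpow_mul,
    zpow_ofNat, hh, one_zpow, one_mul]

/-- The coordinates on `K10` with respect to the basis `1, a ⊗ a, u ⊗ u, u ⊗ v - v ⊗ u,
u ⊗ v + v ⊗ u, v ⊗ v, u ⊗ a + a ⊗ u, v ⊗ a + a ⊗ v, u ⊗ a - a ⊗ u, v ⊗ a - a ⊗ v`. -/
def ofSymmCoord (hF : (2 : F) ≠ 0) : (Fin 10 → F) ≃ₗ[F] K10 F :=
  LinearEquiv.trans
    { toFun := fun x => ![x 0, x 1, x 2, x 4 + x 3, x 4 - x 3, x 5, x 6 + x 8, x 7 + x 9,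
        x 6 - x 8, x 7 - x 9]
      invFun := fun x => ![x 0, x 1, x 2, (x 3 - x 4) / 2, (x 3 + x 4) / 2, x 5, (x 6 + x 8) / 2,
        (x 7 + x 9) / 2, (x 6 - x 8) / 2, (x 7 - x 9) / 2]
      left_inv := by intro x; ext i; fin_cases i <;> simp <;> field_simp <;> ring
      right_inv := by intro x; ext i; fin_cases i <;> simp <;> field_simp <;> ring
      map_add' := by intro x y; ext i; fin_cases i <;> simp <;> ring
      map_smul' := by intro c x; ext i; fin_cases i <;> simp <;> ring }
    (ofCoord F)

theorem ofSymmCoord_apply (hF : (2 : F) ≠ 0) (x : Fin 10 → F) : ofSymmCoord hF x =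
    ofCoord F ![x 0, x 1, x 2, x 4 + x 3, x 4 - x 3, x 5, x 6 + x 8, x 7 + x 9,
        x 6 - x 8, x 7 - x 9] := rfl

theorem ofSymmCoord_mul (hF : (2 : F) ≠ 0) (x y : Fin 10 → F) :
    mul F (ofSymmCoord hF x) (ofSymmCoord hF y) = ofSymmCoord hF (
      let E := x 2 * y 5 + x 5 * y 2 - 2 * (x 4 * y 4) + 2 * (x 3 * y 3)
      let D := 2 * (x 6 * y 7 + x 8 * y 9 - x 7 * y 6 - x 9 * y 8)
      ![x 0 * y 0 - 3 / 16 * (x 1 * y 1) + 3 / 4 * E - 3 / 8 * D,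
        x 0 * y 1 + x 1 * y 0 + x 1 * y 1 - E + D,
        x 0 * y 2 + x 2 * y 0 + (x 1 * y 2 + x 2 * y 1) / 4 + (x 8 * y 6 - x 6 * y 8) / 2,
        x 0 * y 3 + x 3 * y 0 + (x 1 * y 3 + x 3 * y 1) / 4
          + (x 6 * y 7 - x 7 * y 6 - x 8 * y 9 + x 9 * y 8) / 4,
        x 0 * y 4 + x 4 * y 0 + (x 1 * y 4 + x 4 * y 1) / 4
          + (x 8 * y 7 - x 6 * y 9 + x 9 * y 6 - x 7 * y 8) / 4,
        x 0 * y 5 + x 5 * y 0 + (x 1 * y 5 + x 5 * y 1) / 4 + (x 9 * y 7 - x 7 * y 9) / 2,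
        x 0 * y 6 + x 6 * y 0 + (x 1 * y 6 + x 6 * y 1) / 2
          + (x 4 * y 8 - x 2 * y 9 - x 3 * y 6 + x 8 * y 4 - x 9 * y 2 - x 6 * y 3) / 2,
        x 0 * y 7 + x 7 * y 0 + (x 1 * y 7 + x 7 * y 1) / 2
          + (x 5 * y 8 - x 4 * y 9 - x 3 * y 7 + x 8 * y 5 - x 9 * y 4 - x 7 * y 3) / 2,
        x 0 * y 8 + x 8 * y 0 + (x 1 * y 8 + x 8 * y 1) / 2
          + (x 2 * y 7 - x 4 * y 6 + x 3 * y 8 + x 7 * y 2 - x 6 * y 4 + x 8 * y 3) / 2,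
        x 0 * y 9 + x 9 * y 0 + (x 1 * y 9 + x 9 * y 1) / 2
          + (x 4 * y 7 + x 3 * y 9 - x 5 * y 6 + x 7 * y 4 + x 9 * y 3 - x 6 * y 5) / 2]) := by
  have h4 : (4 : F) = 2 * 2 := by norm_num
  have h2 : (2 : F)⁻¹ * 2 = 1 := inv_mul_cancel₀ hF
  rw [ofSymmCoord_apply, ofSymmCoord_apply, ofSymmCoord_apply, ofCoord_mul]
  congr 1
  ext i
  fin_cases i <;> simp [h4] <;> field_simp <;> ring

namespace Grading

/-- The grading of the first type with given degrees. -/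
def gamma1 (F : Type w) [Field F] (g₁ g₂ : G) : Grading F G :=
  gradingOfCoord (ofCoord F) (degree1 g₁ g₂)
    (by
      intro x y k H
      have H (i j) (h) : x i * y j = 0 := H i j (degree1_mul h)
      rw [ofCoord_mul, LinearEquiv.symm_apply_apply]
      fin_cases k
      · simp [H 0 0, H 1 1, H 2 5, H 5 2, H 3 4, H 4 3, H 6 7, H 7 6, H 8 9, H 9 8]
      · simp [H 0 1, H 1 0, H 1 1, H 2 5, H 5 2, H 3 4, H 4 3, H 6 7, H 7 6, H 8 9, H 9 8]
      · simp [H 0 2, H 2 0, H 1 2, H 2 1, H 6 8, H 8 6]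
      · simp [H 0 3, H 3 0, H 1 3, H 3 1, H 6 9, H 9 6]
      · simp [H 0 4, H 4 0, H 1 4, H 4 1, H 7 8, H 8 7]
      · simp [H 0 5, H 5 0, H 1 5, H 5 1, H 7 9, H 9 7]
      · simp [H 0 6, H 6 0, H 1 6, H 6 1, H 2 9, H 9 2, H 3 8, H 8 3]
      · simp [H 0 7, H 7 0, H 1 7, H 7 1, H 4 9, H 9 4, H 5 8, H 8 5]
      · simp [H 0 8, H 8 0, H 1 8, H 8 1, H 4 6, H 6 4, H 2 7, H 7 2]
      · simp [H 0 9, H 9 0, H 1 9, H 9 1, H 5 6, H 6 5, H 3 7, H 7 3])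
    (by
      intro i
      rw [ofCoord_mem_evenPart, ofCoord_mem_oddPart]
      fin_cases i <;> simp)

/-- The grading of the second type with given degrees. -/
def gamma2 (hF : (2 : F) ≠ 0) (g : G) {h : G} (hh : h ^ 2 = 1) : Grading F G :=
  gradingOfCoord (ofSymmCoord hF) (degree2 g h)
    (by
      intro x y k H
      have H (i j) (h) : x i * y j = 0 := H i j (degree2_mul hh h)
      rw [ofSymmCoord_mul, LinearEquiv.symm_apply_apply]
      fin_cases k
      · simp [H 0 0, H 1 1, H 2 5, H 5 2, H 3 3, H 4 4, H 6 7, H 7 6, H 8 9, H 9 8]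
      · simp [H 0 1, H 1 0, H 1 1, H 2 5, H 5 2, H 3 3, H 4 4, H 6 7, H 7 6, H 8 9, H 9 8]
      · simp [H 0 2, H 2 0, H 1 2, H 2 1, H 6 8, H 8 6]
      · simp [H 0 3, H 3 0, H 1 3, H 3 1, H 6 7, H 7 6, H 8 9, H 9 8]
      · simp [H 0 4, H 4 0, H 1 4, H 4 1, H 7 8, H 8 7, H 6 9, H 9 6]
      · simp [H 0 5, H 5 0, H 1 5, H 5 1, H 7 9, H 9 7]
      · simp [H 0 6, H 6 0, H 1 6, H 6 1, H 2 9, H 9 2, H 3 6, H 6 3, H 4 8, H 8 4]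
      · simp [H 0 7, H 7 0, H 1 7, H 7 1, H 4 9, H 9 4, H 5 8, H 8 5, H 3 7, H 7 3]
      · simp [H 0 8, H 8 0, H 1 8, H 8 1, H 4 6, H 6 4, H 2 7, H 7 2, H 3 8, H 8 3]
      · simp [H 0 9, H 9 0, H 1 9, H 9 1, H 5 6, H 6 5, H 4 7, H 7 4, H 3 9, H 9 3])
    (by
      intro i
      rw [ofSymmCoord_apply, ofCoord_mem_evenPart, ofCoord_mem_oddPart]
      fin_cases i <;> simp)

end Grading

end

/-! ### Uniqueness: the degrees of four odd vectors determine the grading. -/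

section

variable {F : Type w} [Field F] {G : Type u} [CommGroup G]

open K10

namespace Grading

/-- The even basis vectors are combinations of `1` and products of the four odd ones, so their
degrees are forced. -/
theorem isGamma1_iff (hF : (2 : F) ≠ 0) {Γ : Grading F G} {g₁ g₂ : G} :
    Γ.IsGamma1 g₁ g₂ ↔ Γ.comp = coordComp (ofCoord F) (degree1 g₁ g₂) := by
  have h4 : (4 : F) ≠ 0 := by
    have : (4 : F) = 2 * 2 := by norm_num
    rw [this]
    exact mul_ne_zero hF hF
  have e6 : tmul (K3.u F) (K3.a F) = ofCoord F (Pi.single 6 1) := by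
    rw [tmul_eq_ofCoord]
    congr 1
    ext i
    fin_cases i <;> simp [K3.u, K3.a, K3.odd]
  have e7 : tmul (K3.v F) (K3.a F) = ofCoord F (Pi.single 7 1) := by
    rw [tmul_eq_ofCoord]
    congr 1
    ext i
    fin_cases i <;> simp [K3.v, K3.a, K3.odd]
  have e8 : tmul (K3.a F) (K3.u F) = ofCoord F (Pi.single 8 1) := by
    rw [tmul_eq_ofCoord]
    congr 1
    ext i
    fin_cases i <;> simp [K3.u, K3.a, K3.odd]
  have e9 : tmul (K3.a F) (K3.v F) = ofCoord F (Pi.single 9 1) := by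
    rw [tmul_eq_ofCoord]
    congr 1
    ext i
    fin_cases i <;> simp [K3.v, K3.a, K3.odd]
  have e0 : one F = ofCoord F (Pi.single 0 1) := by
    rw [one_eq_ofCoord]
    congr 1
    ext i
    fin_cases i <;> simp
  have d6 : degree1 g₁ g₂ 6 = g₁ := by simp [degree1]
  have d7 : degree1 g₁ g₂ 7 = g₁⁻¹ := by simp [degree1]
  have d8 : degree1 g₁ g₂ 8 = g₂ := by simp [degree1]
  have d9 : degree1 g₁ g₂ 9 = g₂⁻¹ := by simp [degree1]
  rw [IsGamma1, e6, e7, e8, e9]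
  constructor
  · rintro ⟨h6, h7, h8, h9⟩
    rw [← d6] at h6
    rw [← d7] at h7
    rw [← d8] at h8
    rw [← d9] at h9
    refine Γ.comp_eq_coordComp _ _ fun i => ?_
    have hone := Γ.one_mem
    rw [e0] at hone
    have key (c : F) (j k l : Fin 10)
        (hj : ofCoord F (Pi.single j 1) ∈ Γ.comp (degree1 g₁ g₂ j))
        (hk : ofCoord F (Pi.single k 1) ∈ Γ.comp (degree1 g₁ g₂ k))
        (hd : degree1 g₁ g₂ j * degree1 g₁ g₂ k = degree1 g₁ g₂ l) :
        c • mul F (ofCoord F (Pi.single j 1)) (ofCoord F (Pi.single k 1))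
          ∈ Γ.comp (degree1 g₁ g₂ l) :=
      hd ▸ Submodule.smul_mem _ _ (Γ.mul_mem _ _ _ hj _ hk)
    simp only [ofCoord_mul] at key
    have d0 : degree1 g₁ g₂ 0 = 1 := by simp [degree1]
    have d1 : degree1 g₁ g₂ 1 = 1 := by simp [degree1]
    rw [← d1] at hone
    fin_cases i
    · simpa [d0, d1] using hone
    · change ofCoord F (Pi.single 1 1) ∈ Γ.comp (degree1 g₁ g₂ 1)
      -- `(u ⊗ a)(v ⊗ a) = a ⊗ a - (3/8) 1`, and `1` is known to have degree `e`.
      have h67 := key 1 6 7 1 h6 h7 (degree1_mul (by decide))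
      convert add_mem h67 (Submodule.smul_mem _ (3 / 8 : F) hone) using 1
      simp only [← map_smul, ← map_add]
      congr 1
      ext i
      fin_cases i <;> simp
    · change ofCoord F (Pi.single 2 1) ∈ Γ.comp (degree1 g₁ g₂ 2)
      convert key 4 6 8 2 h6 h8 (degree1_mul (by decide)) using 1
      simp only [← map_smul]
      congr 1
      ext i
      fin_cases i <;> simp [h4]
    · change ofCoord F (Pi.single 3 1) ∈ Γ.comp (degree1 g₁ g₂ 3)
      convert key 4 6 9 3 h6 h9 (degree1_mul (by decide)) using 1
      simp only [← map_smul]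
      congr 1
      ext i
      fin_cases i <;> simp [h4]
    · change ofCoord F (Pi.single 4 1) ∈ Γ.comp (degree1 g₁ g₂ 4)
      convert key 4 7 8 4 h7 h8 (degree1_mul (by decide)) using 1
      simp only [← map_smul]
      congr 1
      ext i
      fin_cases i <;> simp [h4]
    · change ofCoord F (Pi.single 5 1) ∈ Γ.comp (degree1 g₁ g₂ 5)
      convert key 4 7 9 5 h7 h9 (degree1_mul (by decide)) using 1
      simp only [← map_smul]
      congr 1
      ext i
      fin_cases i <;> simp [h4]
    · exact h6
    · exact h7
    · exact h8
    · exact h9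
  · intro h
    have hb := basis_mem_coordComp (ofCoord F) (degree1 g₁ g₂)
    have h6 := hb 6
    have h7 := hb 7
    have h8 := hb 8
    have h9 := hb 9
    rw [d6] at h6
    rw [d7] at h7
    rw [d8] at h8
    rw [d9] at h9
    rw [h]
    exact ⟨h6, h7, h8, h9⟩

set_option maxHeartbeats 1000000 in
theorem isGamma2_iff (hF : (2 : F) ≠ 0) {Γ : Grading F G} {g h : G} (hh : h ^ 2 = 1) :
    Γ.IsGamma2 g h ↔ Γ.comp = coordComp (ofSymmCoord hF) (degree2 g h) := by
  have h4 : (4 : F) = 2 * 2 := by norm_num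
  have hinv : h⁻¹ = h := inv_eq_of_mul_eq_one_left (by rw [← sq, hh])
  have e6 : tmul (K3.u F) (K3.a F) + tmul (K3.a F) (K3.u F)
      = ofSymmCoord hF (Pi.single 6 1) := by
    rw [tmul_eq_ofCoord, tmul_eq_ofCoord, ← map_add, ofSymmCoord_apply]
    congr 1
    ext i
    fin_cases i <;> simp [K3.u, K3.a, K3.odd]
  have e7 : tmul (K3.v F) (K3.a F) + tmul (K3.a F) (K3.v F)
      = ofSymmCoord hF (Pi.single 7 1) := by
    rw [tmul_eq_ofCoord, tmul_eq_ofCoord, ← map_add, ofSymmCoord_apply]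
    congr 1
    ext i
    fin_cases i <;> simp [K3.v, K3.a, K3.odd]
  have e8 : tmul (K3.u F) (K3.a F) - tmul (K3.a F) (K3.u F)
      = ofSymmCoord hF (Pi.single 8 1) := by
    rw [tmul_eq_ofCoord, tmul_eq_ofCoord, ← map_sub, ofSymmCoord_apply]
    congr 1
    ext i
    fin_cases i <;> simp [K3.u, K3.a, K3.odd]
  have e9 : tmul (K3.v F) (K3.a F) - tmul (K3.a F) (K3.v F)
      = ofSymmCoord hF (Pi.single 9 1) := by
    rw [tmul_eq_ofCoord, tmul_eq_ofCoord, ← map_sub, ofSymmCoord_apply]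
    congr 1
    ext i
    fin_cases i <;> simp [K3.v, K3.a, K3.odd]
  have e0 : one F = ofSymmCoord hF (Pi.single 0 1) := by
    rw [one_eq_ofCoord, ofSymmCoord_apply]
    congr 1
    ext i
    fin_cases i <;> simp
  have d6 : degree2 g h 6 = g := by simp [degree2]
  have d7 : degree2 g h 7 = g⁻¹ := by simp [degree2]
  have d8 : degree2 g h 8 = g * h := by simp [degree2]
  have d9 : degree2 g h 9 = (g * h)⁻¹ := by simp [degree2, hinv, mul_comm]
  rw [IsGamma2, e6, e7, e8, e9]
  constructor
  · rintro ⟨h6, h7, h8, h9⟩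
    rw [← d6] at h6
    rw [← d7] at h7
    rw [← d8] at h8
    rw [← d9] at h9
    refine Γ.comp_eq_coordComp _ _ fun i => ?_
    have hone := Γ.one_mem
    rw [e0] at hone
    have key (c : F) (j k l : Fin 10)
        (hj : ofSymmCoord hF (Pi.single j 1) ∈ Γ.comp (degree2 g h j))
        (hk : ofSymmCoord hF (Pi.single k 1) ∈ Γ.comp (degree2 g h k))
        (hd : degree2 g h j * degree2 g h k = degree2 g h l) :
        c • mul F (ofSymmCoord hF (Pi.single j 1)) (ofSymmCoord hF (Pi.single k 1))
          ∈ Γ.comp (degree2 g h l) :=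
      hd ▸ Submodule.smul_mem _ _ (Γ.mul_mem _ _ _ hj _ hk)
    simp only [ofSymmCoord_mul] at key
    have d0 : degree2 g h 0 = 1 := by simp [degree2]
    have d1 : degree2 g h 1 = 1 := by simp [degree2]
    have d3 : degree2 g h 3 = 1 := by simp [degree2]
    rw [← d1] at hone
    fin_cases i
    · simpa [d0, d1] using hone
    · change ofSymmCoord hF (Pi.single 1 1) ∈ Γ.comp (degree2 g h 1)
      -- The symmetric and the antisymmetric pair give products with opposite `u ⊗ v - v ⊗ u` terms
      -- and equal remaining terms: their sum isolates `a ⊗ a` modulo `1`, and their difference,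
      -- used below, isolates `u ⊗ v - v ⊗ u`.
      have h67 := key (1 / 4) 6 7 1 h6 h7 (degree2_mul hh (by decide))
      have h89 := key (1 / 4) 8 9 1 h8 h9 (degree2_mul hh (by decide))
      convert add_mem (add_mem h67 h89) (Submodule.smul_mem _ (3 / 8 : F) hone) using 1
      simp only [← map_smul, ← map_add]
      congr 1
      ext i
      fin_cases i <;> simp [h4] <;> field_simp <;> norm_num
    · change ofSymmCoord hF (Pi.single 2 1) ∈ Γ.comp (degree2 g h 2)
      convert key 2 8 6 2 h8 h6 (degree2_mul hh (by decide)) using 1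
      simp only [← map_smul]
      congr 1
      ext i
      fin_cases i <;> simp [h4] <;> field_simp
    · change ofSymmCoord hF (Pi.single 3 1) ∈ Γ.comp (degree2 g h 3)
      have h67 := key 2 6 7 3 h6 h7 (degree2_mul hh (by decide))
      have h89 := key 2 8 9 3 h8 h9 (degree2_mul hh (by decide))
      convert sub_mem h67 h89 using 1
      simp only [← map_smul, ← map_sub]
      congr 1
      ext i
      fin_cases i <;> simp [h4] <;> field_simp <;> norm_num
    · change ofSymmCoord hF (Pi.single 4 1) ∈ Γ.comp (degree2 g h 4)
      convert key 4 8 7 4 h8 h7 (degree2_mul hh (by decide)) using 1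
      simp only [← map_smul]
      congr 1
      ext i
      fin_cases i <;> simp [h4] <;> field_simp
    · change ofSymmCoord hF (Pi.single 5 1) ∈ Γ.comp (degree2 g h 5)
      convert key 2 9 7 5 h9 h7 (degree2_mul hh (by decide)) using 1
      simp only [← map_smul]
      congr 1
      ext i
      fin_cases i <;> simp [h4] <;> field_simp
    · exact h6
    · exact h7
    · exact h8
    · exact h9
  · intro H
    have hb := basis_mem_coordComp (ofSymmCoord hF) (degree2 g h)
    have h6 := hb 6
    have h7 := hb 7
    have h8 := hb 8
    have h9 := hb 9
    rw [d6] at h6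
    rw [d7] at h7
    rw [d8] at h8
    rw [d9] at h9
    rw [H]
    exact ⟨h6, h7, h8, h9⟩

theorem existsUnique_isGamma1 (hF : (2 : F) ≠ 0) (g₁ g₂ : G) :
    ∃! Γ : Grading F G, Γ.IsGamma1 g₁ g₂ :=
  ⟨gamma1 F g₁ g₂, (isGamma1_iff hF).2 rfl, fun _ h => Grading.ext ((isGamma1_iff hF).1 h)⟩

theorem existsUnique_isGamma2 (hF : (2 : F) ≠ 0) (g : G) {h : G} (hh : h ^ 2 = 1) :
    ∃! Γ : Grading F G, Γ.IsGamma2 g h :=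
  ⟨gamma2 hF g hh, (isGamma2_iff hF hh).2 rfl,
    fun _ h => Grading.ext ((isGamma2_iff hF hh).1 h)⟩

end Grading

end

/-! ### The form, the flip and the triple product on the odd part. -/

section

variable {F : Type w} [Field F] {G : Type u} [CommGroup G]

open K10

/-- The nondegenerate skew-symmetric form on the odd part `W × W` of `K10`. -/
def oddForm (m n : (Fin 2 → F) × (Fin 2 → F)) : F := K3.skew m.1 n.1 + K3.skew m.2 n.2

/-- The involution of the odd part `W × W` that changes the sign of the second component. -/
def oddFlip (m : (Fin 2 → F) × (Fin 2 → F)) : (Fin 2 → F) × (Fin 2 → F) := (m.1, -m.2)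

/-- Eight times the triple product `(m n) p` on the odd part `W × W`. -/
def oddTriple (m n p : (Fin 2 → F) × (Fin 2 → F)) : (Fin 2 → F) × (Fin 2 → F) :=
  oddForm m n • p +
    (K3.skew n.2 p.2 • m.1 - K3.skew m.2 p.2 • n.1, K3.skew n.1 p.1 • m.2 - K3.skew m.1 p.1 • n.2)

theorem mul_mul_oddMap (hF : (2 : F) ≠ 0) (m n p : (Fin 2 → F) × (Fin 2 → F)) :
    (8 : F) • mul F (mul F (oddMap F m) (oddMap F n)) (oddMap F p)
      = oddMap F (oddTriple m n p) := by
  have h8 : (8 : F) = 2 * (2 * 2) := by norm_num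
  have h4 : (4 : F) = 2 * 2 := by norm_num
  rw [oddMap_apply, oddMap_apply, oddMap_apply, ofCoord_mul, ofCoord_mul, oddMap_apply, ← map_smul]
  congr 1
  ext i
  fin_cases i <;> simp [oddTriple, oddForm, K3.skew, h8, h4] <;> field_simp <;> ring

/-- Put `b = oddForm m n`. The operator `oddTriple m n` is `b` plus an operator exchanging the two
copies of `W`, whose square is the scalar `K3.skew m.1 n.1 * K3.skew m.2 n.2`. -/
theorem oddTriple_oddTriple (m n p : (Fin 2 → F) × (Fin 2 → F)) :
    oddTriple m n (oddTriple m n p) + (oddForm m n ^ 2 - K3.skew m.1 n.1 * K3.skew m.2 n.2) • p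
      = (2 * oddForm m n) • oddTriple m n p := by
  ext i <;> fin_cases i <;> simp [oddTriple, oddForm, K3.skew] <;> ring

/-- The flip enters the triple product only through the left side; the other terms involve `oddForm`
alone, so homogeneity of the form transfers to the left side. -/
theorem two_smul_oddTriple (m n p : (Fin 2 → F) × (Fin 2 → F)) :
    oddForm (oddFlip m) p • oddFlip n - oddForm (oddFlip n) p • oddFlip m
      = (2 : F) • oddTriple m n p - (2 * oddForm m n) • p - oddForm n p • m + oddForm m p • n := by
  ext i <;> fin_cases i <;> simp [oddTriple, oddForm, oddFlip, K3.skew] <;> ring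

theorem oddForm_add (m n p : (Fin 2 → F) × (Fin 2 → F)) :
    oddForm m (n + p) = oddForm m n + oddForm m p := by
  simp [oddForm, K3.skew]; ring

theorem eq_zero_of_oddForm {m : (Fin 2 → F) × (Fin 2 → F)} (h : ∀ n, oddForm m n = 0) : m = 0 := by
  have h1 := h (![0, 1], 0)
  have h2 := h (![1, 0], 0)
  have h3 := h (0, ![0, 1])
  have h4 := h (0, ![1, 0])
  simp [oddForm, K3.skew] at h1 h2 h3 h4
  ext i <;> fin_cases i <;> simpa

/-! ### Homogeneity of the form and of the flip; normal forms of a grading. -/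

namespace Grading

/-- The homogeneous components of the odd part `W × W`. -/
def oddComp (Γ : Grading F G) (g : G) : Submodule F ((Fin 2 → F) × (Fin 2 → F)) :=
  (Γ.comp g).comap (oddMap F)

theorem mem_oddComp {Γ : Grading F G} {g : G} {m : (Fin 2 → F) × (Fin 2 → F)} :
    m ∈ Γ.oddComp g ↔ oddMap F m ∈ Γ.comp g := Iff.rfl

theorem oddComp_eq_zero (Γ : Grading F G) {g h : G} (hgh : g ≠ h)
    {m : (Fin 2 → F) × (Fin 2 → F)} (hg : m ∈ Γ.oddComp g) (hh : m ∈ Γ.oddComp h) : m = 0 := by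
  have := mem_eq_zero_of_ne Γ.independent hgh hg hh
  rwa [map_eq_zero_iff _ oddMap_injective] at this

theorem iSup_oddComp (Γ : Grading F G) : ⨆ g, Γ.oddComp g = ⊤ := by
  let ρ : K10 F →ₗ[F] (Fin 2 → F) × (Fin 2 → F) :=
    { toFun := fun X => (![(ofCoord F).symm X 6, (ofCoord F).symm X 7],
        ![(ofCoord F).symm X 8, (ofCoord F).symm X 9])
      map_add' := by intro X Y; simp
      map_smul' := by intro c X; simp }
  have hodd (m) : ρ (oddMap F m) = m := by
    rw [oddMap_apply]
    ext i <;> fin_cases i <;> simp [ρ]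
  have heven (X) (hX : X ∈ evenPart F) : ρ X = 0 := by
    obtain ⟨x, rfl⟩ := (ofCoord F).surjective X
    have := ofCoord_mem_evenPart.1 hX
    ext i <;> fin_cases i <;> simp [ρ, this]
  refine eq_top_iff.2 fun m _ => ?_
  rw [← hodd m]
  refine induction_on_components Γ.iSup_eq_top (p := fun X => ρ X ∈ ⨆ g, Γ.oddComp g) _
    (fun g X hX => ?_) (by simp) (fun X Y hX hY => by rw [map_add]; exact add_mem hX hY)
  rw [Γ.super g] at hX
  obtain ⟨Y, hY, Z, hZ, rfl⟩ := Submodule.mem_sup.1 hX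
  obtain ⟨n, rfl⟩ := mem_oddPart.1 hZ.2
  rw [map_add, heven Y hY.2, hodd, zero_add]
  exact Submodule.mem_iSup_of_mem g hZ.1

theorem oddTriple_mem (hF : (2 : F) ≠ 0) (Γ : Grading F G) {g k l : G}
    {m n p : (Fin 2 → F) × (Fin 2 → F)} (hm : m ∈ Γ.oddComp g) (hn : n ∈ Γ.oddComp k)
    (hp : p ∈ Γ.oddComp l) : oddTriple m n p ∈ Γ.oddComp (g * k * l) := by
  rw [mem_oddComp, ← mul_mul_oddMap hF]
  exact Submodule.smul_mem _ _ (Γ.mul_mem _ _ _ (Γ.mul_mem _ _ _ hm _ hn) _ hp)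

/-- The skew-symmetric form on the odd part is homogeneous of trivial degree. -/
theorem oddForm_eq_zero (hF : (2 : F) ≠ 0) (Γ : Grading F G) {g k : G}
    {m n : (Fin 2 → F) × (Fin 2 → F)} (hm : m ∈ Γ.oddComp g) (hn : n ∈ Γ.oddComp k)
    (hgk : g * k ≠ 1) : oddForm m n = 0 := by
  by_contra hb
  have key (p) : oddTriple m n p = 0 := by
    refine induction_on_components Γ.iSup_oddComp (p := fun p => oddTriple m n p = 0) p
      (fun l p hp => ?_) ?_ fun p p' hp hp' => ?_
    · obtain ⟨π, h1, h0⟩ :=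
        exists_component_projection Γ.independent Γ.iSup_eq_top (g * k * l)
      have hT := oddTriple_mem hF Γ hm hn hp
      have hTT := oddTriple_mem hF Γ hm hn hT
      -- With `T = oddTriple m n`, the vectors `p`, `T p`, `T (T p)` have degrees `l`, `gkl`,
      -- `(gk)²l`. As `gk ≠ e`, the middle degree differs from the other two, and projecting onto it
      -- leaves `0 = 2 b T p` with `b = oddForm m n`.
      have h := congrArg (fun q => π (oddMap F q)) (oddTriple_oddTriple m n p)
      simp only [map_add, map_smul] at h
      rw [h1 _ hT, h0 _ _ _ hTT, h0 _ _ _ hp, smul_zero, add_zero, eq_comm,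
        smul_eq_zero_iff_right (mul_ne_zero hF hb), map_eq_zero_iff _ oddMap_injective] at h
      · exact h
      · simpa [eq_comm] using hgk
      · simpa using hgk
    · ext i <;> fin_cases i <;> simp [oddTriple, K3.skew]
    · have : oddTriple m n (p + p') = oddTriple m n p + oddTriple m n p' := by
        ext i <;> fin_cases i <;> simp [oddTriple, K3.skew] <;> ring
      rw [this, hp, hp', add_zero]
  -- On a vector with zero second component, the first component of the triple product is just
  -- `oddForm m n` times that of the vector.
  have h := congrArg (fun q => q.1 0) (key (![1, 0], 0))
  simp [oddTriple, K3.skew] at h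
  exact hb h

theorem exists_oddForm_ne_zero (Γ : Grading F G) {m : (Fin 2 → F) × (Fin 2 → F)} (hm : m ≠ 0) :
    ∃ k, ∃ n ∈ Γ.oddComp k, oddForm m n ≠ 0 := by
  by_contra! H
  refine hm (eq_zero_of_oddForm fun n => ?_)
  refine induction_on_components Γ.iSup_oddComp (p := fun n => oddForm m n = 0) n H ?_ ?_
  · simp [oddForm, K3.skew]
  · intro n n' h h'
    rw [oddForm_add, h, h', add_zero]

theorem oddFlip_triple_mem (hF : (2 : F) ≠ 0) (Γ : Grading F G) {g k l : G}
    {m n p : (Fin 2 → F) × (Fin 2 → F)} (hm : m ∈ Γ.oddComp g) (hn : n ∈ Γ.oddComp k)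
    (hp : p ∈ Γ.oddComp l) :
    oddForm (oddFlip m) p • oddFlip n - oddForm (oddFlip n) p • oddFlip m
      ∈ Γ.oddComp (g * k * l) := by
  have key {g k l : G} {m n p : (Fin 2 → F) × (Fin 2 → F)} (hm : m ∈ Γ.oddComp g)
      (hn : n ∈ Γ.oddComp k) (hp : p ∈ Γ.oddComp l) : oddForm m n • p ∈ Γ.oddComp (g * k * l) := by
    by_cases hgk : g * k = 1
    · rw [hgk, one_mul]
      exact Submodule.smul_mem _ _ hp
    · rw [oddForm_eq_zero hF Γ hm hn hgk, zero_smul]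
      exact zero_mem _
  rw [two_smul_oddTriple, mul_smul]
  refine add_mem (sub_mem (sub_mem ?_ ?_) ?_) ?_
  · exact Submodule.smul_mem _ _ (oddTriple_mem hF Γ hm hn hp)
  · exact Submodule.smul_mem _ _ (key hm hn hp)
  · have := key hn hp hm
    rwa [mul_comm, ← mul_assoc] at this
  · have := key hm hp hn
    rwa [mul_right_comm] at this

/-- Put `p = m` in the flip identity: `oddForm (oddFlip m) m` vanishes, and what remains is a
multiple of `oddFlip m`, nonzero for a suitable homogeneous `n` by nondegeneracy. -/
theorem exists_oddFlip_mem (hF : (2 : F) ≠ 0) (Γ : Grading F G) {g : G}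
    {m : (Fin 2 → F) × (Fin 2 → F)} (hm : m ∈ Γ.oddComp g) : ∃ r, oddFlip m ∈ Γ.oddComp r := by
  by_cases h0 : oddFlip m = 0
  · exact ⟨1, h0 ▸ zero_mem _⟩
  obtain ⟨k, n, hn, hmn⟩ := Γ.exists_oddForm_ne_zero h0
  have h := oddFlip_triple_mem hF Γ hm hn hm
  have h1 : oddForm (oddFlip m) m = 0 := by simp [oddForm, oddFlip, K3.skew]; ring
  have h2 : oddForm (oddFlip n) m = - oddForm (oddFlip m) n := by
    simp [oddForm, oddFlip, K3.skew]; ring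
  rw [h1, h2, zero_smul, zero_sub, neg_smul, neg_neg] at h
  exact ⟨_, (Submodule.smul_mem_iff _ hmn).1 h⟩

/-- The odd part of a grading on `K10`: either both copies of `W` are graded, or the involution
`oddFlip` is homogeneous of a degree `h` of order two. -/
theorem exists_symplectic_bases (hF : (2 : F) ≠ 0) (Γ : Grading F G) :
    ∃ x₁ y₁ x₂ y₂ : Fin 2 → F, K3.skew x₁ y₁ = 1 ∧ K3.skew x₂ y₂ = 1 ∧
      ((∃ g₁ g₂ : G, (x₁, 0) ∈ Γ.oddComp g₁ ∧ (y₁, 0) ∈ Γ.oddComp g₁⁻¹ ∧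
        (0, x₂) ∈ Γ.oddComp g₂ ∧ (0, y₂) ∈ Γ.oddComp g₂⁻¹) ∨
      (∃ g h : G, h ^ 2 = 1 ∧ h ≠ 1 ∧ (x₁, x₂) ∈ Γ.oddComp g ∧ (y₁, y₂) ∈ Γ.oddComp g⁻¹ ∧
        (x₁, -x₂) ∈ Γ.oddComp (g * h) ∧ (y₁, -y₂) ∈ Γ.oddComp (g * h)⁻¹)) := by
  by_cases hP : ∀ g, ∀ m ∈ Γ.oddComp g, oddFlip m ∈ Γ.oddComp g
  · have h1 (g m) (hm : m ∈ Γ.oddComp g) : (m.1, 0) ∈ Γ.oddComp g := by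
      have := Submodule.smul_mem _ (1 / 2 : F) (add_mem hm (hP g m hm))
      convert this using 1
      ext i <;> simp [oddFlip]
      field_simp
      ring
    have h2 (g m) (hm : m ∈ Γ.oddComp g) : (0, m.2) ∈ Γ.oddComp g := by
      have := sub_mem hm (h1 g m hm)
      convert this using 1
      ext i <;> simp
    have e1 : ∃ g, ∃ x y : Fin 2 → F, K3.skew x y = 1 ∧ (x, 0) ∈ Γ.oddComp g ∧
        (y, 0) ∈ Γ.oddComp g⁻¹ := by
      obtain ⟨g, m, hm, hm'⟩ := Γ.exists_oddForm_ne_zero (m := (![1, 0], 0)) (by simp)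
      have hm0 : m.1 ≠ 0 := by rintro h; simp [oddForm, K3.skew, h] at hm'
      obtain ⟨k, n, hn, hmn⟩ := Γ.exists_oddForm_ne_zero (m := (m.1, 0)) (by simp [hm0])
      have hk : g * k = 1 := by
        by_contra hk
        exact hmn (oddForm_eq_zero hF Γ (h1 g m hm) hn hk)
      have hs : K3.skew m.1 n.1 ≠ 0 := by simpa [oddForm, K3.skew] using hmn
      refine ⟨g, m.1, (K3.skew m.1 n.1)⁻¹ • n.1, ?_, h1 g m hm, ?_⟩
      · rw [← inv_mul_cancel₀ hs]
        simp only [K3.skew, Pi.smul_apply, smul_eq_mul]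
        ring
      · rw [inv_eq_of_mul_eq_one_right hk]
        simpa using Submodule.smul_mem _ (K3.skew m.1 n.1)⁻¹ (h1 k n hn)
    have e2 : ∃ g, ∃ x y : Fin 2 → F, K3.skew x y = 1 ∧ (0, x) ∈ Γ.oddComp g ∧
        (0, y) ∈ Γ.oddComp g⁻¹ := by
      obtain ⟨g, m, hm, hm'⟩ := Γ.exists_oddForm_ne_zero (m := (0, ![1, 0])) (by simp)
      have hm0 : m.2 ≠ 0 := by rintro h; simp [oddForm, K3.skew, h] at hm'
      obtain ⟨k, n, hn, hmn⟩ := Γ.exists_oddForm_ne_zero (m := (0, m.2)) (by simp [hm0])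
      have hk : g * k = 1 := by
        by_contra hk
        exact hmn (oddForm_eq_zero hF Γ (h2 g m hm) hn hk)
      have hs : K3.skew m.2 n.2 ≠ 0 := by simpa [oddForm, K3.skew] using hmn
      refine ⟨g, m.2, (K3.skew m.2 n.2)⁻¹ • n.2, ?_, h2 g m hm, ?_⟩
      · rw [← inv_mul_cancel₀ hs]
        simp only [K3.skew, Pi.smul_apply, smul_eq_mul]
        ring
      · rw [inv_eq_of_mul_eq_one_right hk]
        simpa using Submodule.smul_mem _ (K3.skew m.2 n.2)⁻¹ (h2 k n hn)
    obtain ⟨g₁, x₁, y₁, hs₁, hx₁, hy₁⟩ := e1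
    obtain ⟨g₂, x₂, y₂, hs₂, hx₂, hy₂⟩ := e2
    exact ⟨x₁, y₁, x₂, y₂, hs₁, hs₂, Or.inl ⟨g₁, g₂, hx₁, hy₁, hx₂, hy₂⟩⟩
  · push Not at hP
    obtain ⟨g, m, hm, hPm⟩ := hP
    obtain ⟨r, hr⟩ := exists_oddFlip_mem hF Γ hm
    obtain ⟨h, rfl⟩ : ∃ h, r = g * h := ⟨g⁻¹ * r, by simp⟩
    have hh : h ≠ 1 := by rintro rfl; simp at hr; exact hPm hr
    have hm0 : m ≠ 0 := by
      rintro rfl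
      refine hPm ?_
      have : oddFlip (0 : (Fin 2 → F) × (Fin 2 → F)) = 0 := by ext <;> simp [oddFlip]
      rw [this]
      exact zero_mem _
    obtain ⟨k, n, hn, hmn⟩ := Γ.exists_oddForm_ne_zero hm0
    have hk : g * k = 1 := by
      by_contra hk
      exact hmn (oddForm_eq_zero hF Γ hm hn hk)
    obtain rfl : g⁻¹ = k := inv_eq_of_mul_eq_one_right hk
    obtain ⟨l, hl⟩ := exists_oddFlip_mem hF Γ hn
    have hPmn : oddForm (oddFlip m) (oddFlip n) = oddForm m n := by
      simp [oddForm, oddFlip, K3.skew]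
    have hl' : g * h * l = 1 := by
      by_contra hl'
      exact hmn (hPmn ▸ oddForm_eq_zero hF Γ hr hl hl')
    obtain rfl : (g * h)⁻¹ = l := inv_eq_of_mul_eq_one_right hl'
    -- The degrees `g` and `(gh)⁻¹` are not inverse. The vanishing of this value says that both
    -- components of `(m, n)` have the same skew product, so a single scalar `c` normalizes both
    -- bases.
    have hm' : oddForm m (oddFlip n) = 0 :=
      oddForm_eq_zero hF Γ hm hl (by simpa [mul_inv_rev, mul_comm] using hh)
    have hs : K3.skew m.1 n.1 = K3.skew m.2 n.2 := by
      simp [oddForm, oddFlip, K3.skew] at hm' ⊢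
      linear_combination hm'
    have hs0 : K3.skew m.1 n.1 ≠ 0 := by
      intro h
      simp [oddForm, ← hs, h] at hmn
    -- The flip identity for `m`, `oddFlip n`, `m` puts a nonzero multiple of `oddFlip m` in degree
    -- `g (gh)⁻¹ g = g h⁻¹`. Its degree is also `g h`, hence `h = h⁻¹`.
    have h2 : h ^ 2 = 1 := by
      have := oddFlip_triple_mem hF Γ hm hl hm
      have e1 : oddForm (oddFlip m) m = 0 := by simp [oddForm, oddFlip, K3.skew]; ring
      have e2 : oddForm (oddFlip (oddFlip n)) m = - oddForm m n := by
        simp [oddForm, oddFlip, K3.skew]; ring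
      rw [e1, e2, zero_smul, zero_sub, neg_smul, neg_neg, Submodule.smul_mem_iff _ hmn] at this
      have hne : oddFlip m ≠ 0 := fun h => hPm (h ▸ zero_mem _)
      by_contra h2
      refine hne (Γ.oddComp_eq_zero ?_ hr this)
      intro h3
      refine h2 ?_
      have : g * (g * h)⁻¹ * g = g * h⁻¹ := by simp [mul_comm]
      rw [this, mul_right_inj] at h3
      rw [sq]
      nth_rewrite 1 [h3]
      simp
    let c := (K3.skew m.1 n.1)⁻¹
    refine ⟨m.1, c • n.1, m.2, c • n.2, ?_, ?_, Or.inr ⟨g, h, h2, hh, hm, ?_, hr, ?_⟩⟩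
    · rw [← inv_mul_cancel₀ hs0]
      simp only [c, K3.skew, Pi.smul_apply, smul_eq_mul]
      ring
    · rw [← inv_mul_cancel₀ hs0]
      nth_rewrite 2 [hs]
      simp only [c, K3.skew, Pi.smul_apply, smul_eq_mul]
      ring
    · exact Submodule.smul_mem _ c hn
    · have := Submodule.smul_mem _ c hl
      simpa [oddFlip] using this

/-- The image of a grading under an automorphism. -/
def map (Γ : Grading F G) {φ : K10 F ≃ₗ[F] K10 F} (hφ : IsAut φ) : Grading F G where
  comp g := (Γ.comp g).map φ.toLinearMap
  independent := Γ.independent.map_orderIso (Submodule.orderIsoMapComap φ)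
  iSup_eq_top := by
    rw [← Submodule.map_iSup, Γ.iSup_eq_top, Submodule.map_top]
    exact LinearEquiv.range φ
  mul_mem := by
    rintro g h _ ⟨X, hX, rfl⟩ _ ⟨Y, hY, rfl⟩
    exact ⟨_, Γ.mul_mem _ _ X hX Y hY, hφ.1 X Y⟩
  super := by
    intro g
    conv_lhs => rw [Γ.super g]
    rw [Submodule.map_sup, Submodule.map_inf _ φ.injective, Submodule.map_inf _ φ.injective,
      hφ.2.1, hφ.2.2]

theorem iso_map (Γ : Grading F G) {φ : K10 F ≃ₗ[F] K10 F} (hφ : IsAut φ) : Γ.Iso (Γ.map hφ) :=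
  ⟨φ, hφ, fun _ => rfl⟩

theorem tmul_odd_a (x : Fin 2 → F) : tmul (K3.odd x) (K3.a F) = oddMap F (x, 0) := by
  rw [oddMap_apply, tmul_eq_ofCoord]
  simp [K3.odd, K3.a]

theorem tmul_a_odd (x : Fin 2 → F) : tmul (K3.a F) (K3.odd x) = oddMap F (0, x) := by
  rw [oddMap_apply, tmul_eq_ofCoord]
  simp [K3.odd, K3.a]

theorem isGamma1_iff_oddComp {Γ : Grading F G} {g₁ g₂ : G} : Γ.IsGamma1 g₁ g₂ ↔
    (![1, 0], 0) ∈ Γ.oddComp g₁ ∧ (![0, 1], 0) ∈ Γ.oddComp g₁⁻¹ ∧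
      (0, ![1, 0]) ∈ Γ.oddComp g₂ ∧ (0, ![0, 1]) ∈ Γ.oddComp g₂⁻¹ := by
  simp only [IsGamma1, K3.u, K3.v, tmul_odd_a, tmul_a_odd, mem_oddComp]

theorem isGamma2_iff_oddComp {Γ : Grading F G} {g h : G} : Γ.IsGamma2 g h ↔
    (![1, 0], ![1, 0]) ∈ Γ.oddComp g ∧ (![0, 1], ![0, 1]) ∈ Γ.oddComp g⁻¹ ∧
      (![1, 0], -![1, 0]) ∈ Γ.oddComp (g * h) ∧ (![0, 1], -![0, 1]) ∈ Γ.oddComp (g * h)⁻¹ := by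
  simp only [IsGamma2, K3.u, K3.v, tmul_odd_a, tmul_a_odd, mem_oddComp, ← map_add, ← map_sub,
    Prod.mk_add_mk, Prod.mk_sub_mk, add_zero, zero_add, sub_zero, zero_sub]

theorem mem_oddComp_map {Γ : Grading F G} {φ : K10 F ≃ₗ[F] K10 F} (hφ : IsAut φ) {g : G}
    {m n : (Fin 2 → F) × (Fin 2 → F)} (hφn : φ (oddMap F n) = oddMap F m)
    (hn : n ∈ Γ.oddComp g) : m ∈ (Γ.map hφ).oddComp g :=
  ⟨oddMap F n, hn, hφn⟩

theorem exists_isGamma (hF : (2 : F) ≠ 0) (Γ : Grading F G) :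
    (∃ (g₁ g₂ : G) (Γ' : Grading F G), Γ'.IsGamma1 g₁ g₂ ∧ Γ.Iso Γ') ∨
      (∃ (g h : G) (Γ' : Grading F G), h ^ 2 = 1 ∧ h ≠ 1 ∧ Γ'.IsGamma2 g h ∧ Γ.Iso Γ') := by
  obtain ⟨x₁, y₁, x₂, y₂, h₁, h₂, H⟩ := exists_symplectic_bases hF Γ
  -- The automorphism carries the standard bases to the homogeneous ones, so its inverse normalizes
  -- the grading.
  have hφ := (tensorEquiv_isAut (skew_symplecticEquiv x₁ y₁ h₁)
    (skew_symplecticEquiv x₂ y₂ h₂)).symm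
  rcases H with ⟨g₁, g₂, H⟩ | ⟨g, h, hh, hh1, H⟩
  · refine Or.inl ⟨g₁, g₂, Γ.map hφ, isGamma1_iff_oddComp.2 ⟨?_, ?_, ?_, ?_⟩, Γ.iso_map hφ⟩
    · refine mem_oddComp_map hφ ?_ H.1
      simp [LinearEquiv.symm_apply_eq, tensorEquiv_oddMap, symplecticEquiv_apply]
    · refine mem_oddComp_map hφ ?_ H.2.1
      simp [LinearEquiv.symm_apply_eq, tensorEquiv_oddMap, symplecticEquiv_apply]
    · refine mem_oddComp_map hφ ?_ H.2.2.1
      simp [LinearEquiv.symm_apply_eq, tensorEquiv_oddMap, symplecticEquiv_apply]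
    · refine mem_oddComp_map hφ ?_ H.2.2.2
      simp [LinearEquiv.symm_apply_eq, tensorEquiv_oddMap, symplecticEquiv_apply]
  · refine Or.inr ⟨g, h, Γ.map hφ, hh, hh1, isGamma2_iff_oddComp.2 ⟨?_, ?_, ?_, ?_⟩, Γ.iso_map hφ⟩
    · refine mem_oddComp_map hφ ?_ H.1
      simp [LinearEquiv.symm_apply_eq, tensorEquiv_oddMap, symplecticEquiv_apply]
    · refine mem_oddComp_map hφ ?_ H.2.1
      simp [LinearEquiv.symm_apply_eq, tensorEquiv_oddMap, symplecticEquiv_apply]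
    · refine mem_oddComp_map hφ ?_ H.2.2.1
      simp [LinearEquiv.symm_apply_eq, tensorEquiv_oddMap, symplecticEquiv_apply]
    · refine mem_oddComp_map hφ ?_ H.2.2.2
      simp [LinearEquiv.symm_apply_eq, tensorEquiv_oddMap, symplecticEquiv_apply]

end Grading

end

/-! ### Invariants: odd support and determinant degree. -/

section

variable {F : Type w} [Field F] {G : Type u} [CommGroup G]

open K10

namespace Grading

theorem Iso.symm {Γ Γ' : Grading F G} (h : Γ.Iso Γ') : Γ'.Iso Γ := by
  obtain ⟨φ, hφ, hg⟩ := h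
  refine ⟨φ.symm, hφ.symm, fun g => ?_⟩
  rw [← hg]
  ext X
  simp

theorem Iso.refl (Γ : Grading F G) : Γ.Iso Γ :=
  ⟨LinearEquiv.refl F _, IsAut.refl, fun _ => Submodule.map_id _⟩

theorem Iso.trans {Γ Γ' Γ'' : Grading F G} (h : Γ.Iso Γ') (h' : Γ'.Iso Γ'') : Γ.Iso Γ'' := by
  obtain ⟨φ, hφ, hg⟩ := h
  obtain ⟨ψ, hψ, hg'⟩ := h'
  refine ⟨φ.trans ψ, hφ.trans hψ, fun g => ?_⟩
  rw [← hg', ← hg, ← Submodule.map_comp]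
  rfl

theorem Iso.oddComp_ne_bot {Γ Γ' : Grading F G} (h : Γ.Iso Γ') {g : G} (hg : Γ.oddComp g ≠ ⊥) :
    Γ'.oddComp g ≠ ⊥ := by
  obtain ⟨φ, hφ, hc⟩ := h
  obtain ⟨m, hm, hm0⟩ := Submodule.exists_mem_ne_zero_of_ne_bot hg
  obtain ⟨n, hn⟩ := mem_oddPart.1 (hφ.apply_mem_oddPart (oddMap_mem m))
  refine (Submodule.ne_bot_iff _).2 ⟨n, ?_, ?_⟩
  · rw [mem_oddComp, hn, ← hc]
    exact Submodule.mem_map_of_mem hm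
  · rintro rfl
    rw [map_zero, eq_comm, LinearEquiv.map_eq_zero_iff, map_eq_zero_iff _ oddMap_injective] at hn
    exact hm0 hn

/-- If `g` is not among the degrees of a spanning family, projection onto degree `g` kills the
family and hence the component. -/
theorem oddComp_ne_bot_iff {Γ : Grading F G} {ι : Type*} [Fintype ι]
    {m : ι → (Fin 2 → F) × (Fin 2 → F)} {d : ι → G} (hm : ∀ i, m i ∈ Γ.oddComp (d i))
    (h0 : ∀ i, m i ≠ 0) (hs : ∀ x, ∃ c : ι → F, x = ∑ i, c i • m i) {g : G} :
    Γ.oddComp g ≠ ⊥ ↔ ∃ i, d i = g := by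
  constructor
  · intro hg
    by_contra! H
    obtain ⟨π, h1, h0⟩ := exists_component_projection Γ.independent Γ.iSup_eq_top g
    obtain ⟨x, hx, hx0⟩ := Submodule.exists_mem_ne_zero_of_ne_bot hg
    obtain ⟨c, hc⟩ := hs x
    refine hx0 (oddMap_injective ?_)
    rw [map_zero, ← h1 _ hx, hc, map_sum, map_sum]
    refine Finset.sum_eq_zero fun i _ => ?_
    rw [map_smul, map_smul, h0 _ (H i) _ (hm i), smul_zero]
  · rintro ⟨i, rfl⟩
    exact (Submodule.ne_bot_iff _).2 ⟨m i, hm i, h0 i⟩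

theorem IsGamma1.oddComp_ne_bot_iff {Γ : Grading F G} {g₁ g₂ : G} (h : Γ.IsGamma1 g₁ g₂) {g : G} :
    Γ.oddComp g ≠ ⊥ ↔ g ∈ ({g₁, g₁⁻¹, g₂, g₂⁻¹} : Set G) := by
  rw [isGamma1_iff_oddComp] at h
  rw [Grading.oddComp_ne_bot_iff (d := ![g₁, g₁⁻¹, g₂, g₂⁻¹])
    (m := ![(![1, 0], 0), (![0, 1], 0), (0, ![1, 0]), (0, ![0, 1])])]
  · simp [Fin.exists_fin_succ, eq_comm]
  · intro i
    fin_cases i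
    exacts [h.1, h.2.1, h.2.2.1, h.2.2.2]
  · intro i
    fin_cases i <;> simp
  · intro x
    refine ⟨![x.1 0, x.1 1, x.2 0, x.2 1], ?_⟩
    ext i <;> fin_cases i <;> simp [Fin.sum_univ_succ]

theorem IsGamma2.oddComp_ne_bot_iff (hF : (2 : F) ≠ 0) {Γ : Grading F G} {g h : G}
    (hh : h ^ 2 = 1) (H : Γ.IsGamma2 g h) {k : G} :
    Γ.oddComp k ≠ ⊥ ↔ k ∈ ({g, g * h, g⁻¹, g⁻¹ * h} : Set G) := by
  have hinv : h⁻¹ = h := inv_eq_of_mul_eq_one_left (by rw [← sq, hh])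
  rw [isGamma2_iff_oddComp, mul_inv, hinv] at H
  rw [Grading.oddComp_ne_bot_iff (d := ![g, g * h, g⁻¹, g⁻¹ * h])
    (m := ![(![1, 0], ![1, 0]), (![1, 0], -![1, 0]), (![0, 1], ![0, 1]), (![0, 1], -![0, 1])])]
  · simp [Fin.exists_fin_succ, eq_comm]
  · intro i
    fin_cases i
    exacts [H.1, H.2.2.1, H.2.1, H.2.2.2]
  · intro i
    fin_cases i <;> simp
  · intro x
    refine ⟨![(x.1 0 + x.2 0) / 2, (x.1 0 - x.2 0) / 2, (x.1 1 + x.2 1) / 2,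
      (x.1 1 - x.2 1) / 2], ?_⟩
    ext i <;> fin_cases i <;> simp [Fin.sum_univ_succ] <;> field_simp <;> ring

/-- The product of the degrees of a homogeneous basis. -/
def detDegree (Γ : Grading F G) : G := ∏ᶠ g, g ^ Module.finrank F (Γ.comp g)

theorem Iso.detDegree_eq {Γ Γ' : Grading F G} (h : Γ.Iso Γ') : Γ.detDegree = Γ'.detDegree := by
  obtain ⟨φ, hφ, hc⟩ := h
  refine finprod_congr fun g => ?_
  rw [← hc]
  exact congrArg (g ^ ·) (LinearEquiv.finrank_map_eq φ _).symm

theorem detDegree_eq_prod {Γ : Grading F G} {e : (Fin 10 → F) ≃ₗ[F] K10 F} {d : Fin 10 → G}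
    (h : Γ.comp = coordComp e d) : Γ.detDegree = ∏ i, d i := by
  classical
  rw [detDegree, h, finprod_eq_prod_of_mulSupport_subset (s := Finset.univ.image d)]
  · simp only [finrank_coordComp]
    exact (Finset.prod_comp (s := Finset.univ) (fun g : G => g) d).symm
  · intro g hg
    by_contra hg'
    refine hg ?_
    have : (Finset.univ.filter fun i => d i = g) = ∅ := by
      refine Finset.filter_eq_empty_iff.2 fun i _ hi => hg' ?_
      simp [← hi]
    simp [finrank_coordComp, this]

theorem prod_zpow_mul_zpow (g h : G) (a b : Fin 10 → ℤ) :
    ∏ i, g ^ a i * h ^ b i = g ^ (∑ i, a i) * h ^ (∑ i, b i) := by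
  have (g : G) (a : Fin 10 → ℤ) : ∏ i, g ^ a i = g ^ (∑ i, a i) := by
    simp only [Fin.prod_univ_succ, Fin.sum_univ_succ, zpow_add]
    simp
  rw [Finset.prod_mul_distrib, this, this]

theorem IsGamma1.detDegree_eq (hF : (2 : F) ≠ 0) {Γ : Grading F G} {g₁ g₂ : G}
    (h : Γ.IsGamma1 g₁ g₂) : Γ.detDegree = 1 := by
  rw [detDegree_eq_prod ((isGamma1_iff hF).1 h)]
  simp only [degree1]
  rw [prod_zpow_mul_zpow]
  simp [Fin.sum_univ_succ]

theorem IsGamma2.detDegree_eq (hF : (2 : F) ≠ 0) {Γ : Grading F G} {g h : G} (hh : h ^ 2 = 1)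
    (H : Γ.IsGamma2 g h) : Γ.detDegree = h := by
  rw [detDegree_eq_prod ((isGamma2_iff hF hh).1 H)]
  simp only [degree2]
  rw [prod_zpow_mul_zpow]
  -- Five basis vectors carry a factor `h`, and the powers of `g` cancel; the product of the degrees
  -- is `h⁵ = h`.
  have : (∑ i, ![0, 0, 1, 0, 1, 1, 0, 0, 1, 1] i : ℤ) = 2 + 2 + 1 := rfl
  rw [this, zpow_add, zpow_add, zpow_ofNat, hh]
  simp [Fin.sum_univ_succ]

/-! ### Isomorphisms within each type. -/

theorem gamma1_eq (hF : (2 : F) ≠ 0) {Γ : Grading F G} {g₁ g₂ : G} (h : Γ.IsGamma1 g₁ g₂) :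
    Γ = gamma1 F g₁ g₂ :=
  Grading.ext ((isGamma1_iff hF).1 h)

theorem gamma2_eq (hF : (2 : F) ≠ 0) {Γ : Grading F G} {g h : G} (hh : h ^ 2 = 1)
    (H : Γ.IsGamma2 g h) : Γ = gamma2 hF g hh :=
  Grading.ext ((isGamma2_iff hF hh).1 H)

theorem gamma1_iso_swap (hF : (2 : F) ≠ 0) (g₁ g₂ : G) :
    (gamma1 F g₁ g₂).Iso (gamma1 F g₂ g₁) := by
  have h := isGamma1_iff_oddComp.1 ((isGamma1_iff (Γ := gamma1 F g₁ g₂) hF).2 rfl)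
  rw [← gamma1_eq hF (Γ := (gamma1 F g₁ g₂).map swap_isAut) (isGamma1_iff_oddComp.2 ⟨
    mem_oddComp_map swap_isAut (by rw [swap_oddMap]; rfl) h.2.2.1,
    mem_oddComp_map swap_isAut (by rw [swap_oddMap]; rfl) h.2.2.2,
    mem_oddComp_map swap_isAut (by rw [swap_oddMap]; rfl) h.1,
    mem_oddComp_map swap_isAut (by rw [swap_oddMap]; rfl) h.2.1⟩)]
  exact iso_map _ _

/-- The map `u ↦ -v`, `v ↦ u` is symplectic; exchanging the two lines, it inverts the degrees. -/
theorem skew_rotation : K3.skew (F := F) ![0, -1] ![1, 0] = 1 := by simp [K3.skew]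

theorem gamma1_iso_inv_left (hF : (2 : F) ≠ 0) (g₁ g₂ : G) :
    (gamma1 F g₁ g₂).Iso (gamma1 F g₁⁻¹ g₂) := by
  have h := isGamma1_iff_oddComp.1 ((isGamma1_iff (Γ := gamma1 F g₁ g₂) hF).2 rfl)
  have hφ := tensorEquiv_isAut (B := LinearEquiv.refl F _)
    (skew_symplecticEquiv _ _ (skew_rotation (F := F))) (fun _ _ => rfl)
  rw [← gamma1_eq hF (Γ := (gamma1 F g₁ g₂).map hφ) (isGamma1_iff_oddComp.2 ⟨
    mem_oddComp_map hφ (by simp [tensorEquiv_oddMap, symplecticEquiv_apply]) h.2.1,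
    mem_oddComp_map hφ (n := (-![1, 0], 0))
      (by simp [tensorEquiv_oddMap, symplecticEquiv_apply])
      (by simpa using neg_mem h.1),
    mem_oddComp_map hφ (by simp [tensorEquiv_oddMap, symplecticEquiv_apply]) h.2.2.1,
    mem_oddComp_map hφ (by simp [tensorEquiv_oddMap, symplecticEquiv_apply]) h.2.2.2⟩)]
  exact iso_map _ _

theorem gamma1_iso_inv_right (hF : (2 : F) ≠ 0) (g₁ g₂ : G) :
    (gamma1 F g₁ g₂).Iso (gamma1 F g₁ g₂⁻¹) :=
  ((gamma1_iso_swap hF _ _).trans (gamma1_iso_inv_left hF _ _)).trans (gamma1_iso_swap hF _ _)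

theorem gamma2_iso_inv (hF : (2 : F) ≠ 0) (g : G) {h : G} (hh : h ^ 2 = 1) :
    (gamma2 hF g hh).Iso (gamma2 hF g⁻¹ hh) := by
  have hinv : h⁻¹ = h := inv_eq_of_mul_eq_one_left (by rw [← sq, hh])
  have H := isGamma2_iff_oddComp.1 ((isGamma2_iff (Γ := gamma2 hF g hh) hF hh).2 rfl)
  have hφ := tensorEquiv_isAut (skew_symplecticEquiv _ _ (skew_rotation (F := F)))
    (skew_symplecticEquiv _ _ (skew_rotation (F := F)))
  rw [← gamma2_eq hF hh (Γ := (gamma2 hF g hh).map hφ) (isGamma2_iff_oddComp.2 ⟨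
    mem_oddComp_map hφ (by simp [tensorEquiv_oddMap, symplecticEquiv_apply]) H.2.1,
    mem_oddComp_map hφ (n := (-![1, 0], -![1, 0]))
      (by simp [tensorEquiv_oddMap, symplecticEquiv_apply])
      (by simpa using neg_mem H.1),
    mem_oddComp_map hφ (n := (![0, 1], -![0, 1]))
      (by simp [tensorEquiv_oddMap, symplecticEquiv_apply])
      (by simpa [hinv, mul_comm] using H.2.2.2),
    mem_oddComp_map hφ (n := (-![1, 0], ![1, 0]))
      (by simp [tensorEquiv_oddMap, symplecticEquiv_apply])
      (by simpa [hinv, mul_comm] using neg_mem H.2.2.1)⟩)]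
  exact iso_map _ _

theorem gamma2_iso_mul (hF : (2 : F) ≠ 0) (g : G) {h : G} (hh : h ^ 2 = 1) :
    (gamma2 hF g hh).Iso (gamma2 hF (g * h) hh) := by
  have H := isGamma2_iff_oddComp.1 ((isGamma2_iff (Γ := gamma2 hF g hh) hF hh).2 rfl)
  have hghh : g * h * h = g := by rw [mul_assoc, ← sq, hh, mul_one]
  -- The sign on the second factor exchanges the symmetric and antisymmetric odd vectors, hence `g`
  -- and `g h`.
  have hφ := tensorEquiv_isAut (F := F) (A := LinearEquiv.refl F _) (B := LinearEquiv.neg F)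
    (fun _ _ => rfl) (by intro x y; simp [K3.skew])
  rw [← gamma2_eq hF hh (Γ := (gamma2 hF g hh).map hφ) (isGamma2_iff_oddComp.2 ⟨
    mem_oddComp_map hφ (n := (![1, 0], -![1, 0])) (by simp [tensorEquiv_oddMap]) H.2.2.1,
    mem_oddComp_map hφ (n := (![0, 1], -![0, 1])) (by simp [tensorEquiv_oddMap]) H.2.2.2,
    mem_oddComp_map hφ (n := (![1, 0], ![1, 0])) (by simp [tensorEquiv_oddMap])
      (by rw [hghh]; exact H.1),
    mem_oddComp_map hφ (n := (![0, 1], ![0, 1])) (by simp [tensorEquiv_oddMap])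
      (by rw [hghh]; exact H.2.1)⟩)]
  exact iso_map _ _

theorem IsGamma1.iso_iff (hF : (2 : F) ≠ 0) {g₁ g₂ g₁' g₂' : G} {Γ Γ' : Grading F G}
    (h : Γ.IsGamma1 g₁ g₂) (h' : Γ'.IsGamma1 g₁' g₂') :
    Γ.Iso Γ' ↔ ({g₁, g₁⁻¹, g₂, g₂⁻¹} : Set G) = {g₁', g₁'⁻¹, g₂', g₂'⁻¹} := by
  constructor
  · intro hi
    ext g
    rw [← h.oddComp_ne_bot_iff, ← h'.oddComp_ne_bot_iff]
    exact ⟨hi.oddComp_ne_bot, hi.symm.oddComp_ne_bot⟩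
  · intro hs
    rw [gamma1_eq hF h, gamma1_eq hF h']
    have a1 : g₁' ∈ ({g₁, g₁⁻¹, g₂, g₂⁻¹} : Set G) := by rw [hs]; simp
    have a2 : g₂' ∈ ({g₁, g₁⁻¹, g₂, g₂⁻¹} : Set G) := by rw [hs]; simp
    have b1 : g₁ ∈ ({g₁', g₁'⁻¹, g₂', g₂'⁻¹} : Set G) := by rw [← hs]; simp
    have b2 : g₂ ∈ ({g₁', g₁'⁻¹, g₂', g₂'⁻¹} : Set G) := by rw [← hs]; simp
    simp only [Set.mem_insert_iff, Set.mem_singleton_iff] at a1 a2 b1 b2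
    have i1 := inv_inv g₁
    have i2 := inv_inv g₂
    have i1' := inv_inv g₁'
    have i2' := inv_inv g₂'
    -- The set is a union of two classes `{x, x⁻¹}`, which are equal or disjoint, so it determines
    -- the unordered pair of classes even when they coincide.
    have key : ((g₁' = g₁ ∨ g₁' = g₁⁻¹) ∧ (g₂' = g₂ ∨ g₂' = g₂⁻¹)) ∨
        ((g₁' = g₂ ∨ g₁' = g₂⁻¹) ∧ (g₂' = g₁ ∨ g₂' = g₁⁻¹)) := by
      grind
    have iso {a b a' b' : G} (ha : a' = a ∨ a' = a⁻¹) (hb : b' = b ∨ b' = b⁻¹) :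
        (gamma1 F a b).Iso (gamma1 F a' b') := by
      rcases ha with rfl | rfl <;> rcases hb with rfl | rfl
      · exact Iso.refl _
      · exact gamma1_iso_inv_right hF _ _
      · exact gamma1_iso_inv_left hF _ _
      · exact (gamma1_iso_inv_left hF _ _).trans (gamma1_iso_inv_right hF _ _)
    rcases key with ⟨k1, k2⟩ | ⟨k1, k2⟩
    · exact iso k1 k2
    · exact (gamma1_iso_swap hF _ _).trans (iso k1 k2)

theorem IsGamma2.iso_iff (hF : (2 : F) ≠ 0) {g h g' h' : G} {Γ Γ' : Grading F G}
    (hh : h ^ 2 = 1) (hh' : h' ^ 2 = 1) (H : Γ.IsGamma2 g h) (H' : Γ'.IsGamma2 g' h') :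
    Γ.Iso Γ' ↔ h' = h ∧ g' ∈ ({g, g * h, g⁻¹, g⁻¹ * h} : Set G) := by
  constructor
  · intro hi
    refine ⟨?_, ?_⟩
    · rw [← H.detDegree_eq hF hh, ← H'.detDegree_eq hF hh', hi.detDegree_eq]
    · rw [← H.oddComp_ne_bot_iff hF hh]
      refine hi.symm.oddComp_ne_bot ((H'.oddComp_ne_bot_iff hF hh').2 ?_)
      simp
  · rintro ⟨rfl, hg⟩
    rw [gamma2_eq hF hh H, gamma2_eq hF hh H']
    rcases hg with rfl | rfl | rfl | rfl
    · exact Iso.refl _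
    · exact gamma2_iso_mul hF g hh
    · exact gamma2_iso_inv hF g hh
    · exact (gamma2_iso_inv hF g hh).trans (gamma2_iso_mul hF _ hh)

end Grading

end

/-! ### Fine gradings. -/

section

variable {F : Type w} [Field F] {G : Type u} [CommGroup G] {H : Type v} [CommGroup H]

open K10

namespace Grading

/-- Otherwise every component of `Γ'` would lie in the sum of the other components of `Γ`, which
would then be everything. -/
theorem exists_comp_le {Γ : Grading F G} {Γ' : Grading F H}
    (hle : ∀ h, ∃ g, Γ'.comp h ≤ Γ.comp g) {g : G} (hg : Γ.comp g ≠ ⊥) :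
    ∃ h, Γ'.comp h ≠ ⊥ ∧ Γ'.comp h ≤ Γ.comp g := by
  by_contra! hc
  have htop : (⊤ : Submodule F (K10 F)) ≤ ⨆ (j) (_ : j ≠ g), Γ.comp j := by
    rw [← Γ'.iSup_eq_top]
    refine iSup_le fun h => ?_
    by_cases h0 : Γ'.comp h = ⊥
    · rw [h0]
      exact bot_le
    · obtain ⟨j, hj⟩ := hle h
      have hjg : j ≠ g := by
        rintro rfl
        exact hc h h0 hj
      exact hj.trans (le_iSup₂_of_le j hjg le_rfl)
  exact hg (disjoint_top.1 ((Γ.independent g).mono_right htop))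

/-- In a refinement, elements that span a component stay homogeneous. -/
theorem exists_mem_of_refinement {Γ : Grading F G} {Γ' : Grading F H}
    (hle : ∀ h, ∃ g, Γ'.comp h ≤ Γ.comp g) {g : G} (hg : Module.finrank F (Γ.comp g) = 1)
    {X : K10 F} (hX : X ∈ Γ.comp g) : ∃ h, X ∈ Γ'.comp h := by
  have hne : Γ.comp g ≠ ⊥ := by
    intro h
    rw [h, finrank_bot] at hg
    exact zero_ne_one hg
  obtain ⟨h, h0, hh⟩ := exists_comp_le hle hne
  refine ⟨h, ?_⟩
  rwa [Submodule.eq_of_le_of_finrank_le hh]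
  rw [hg]
  exact Nat.one_le_iff_ne_zero.2 (mt Submodule.finrank_eq_zero.1 h0)

/-- Components of dimension at most one cannot be split, and the identity component is assumed to
remain inside one component. -/
theorem not_isProperRefinement {Γ : Grading F G} {Γ' : Grading F H}
    (hdim : ∀ g, g ≠ 1 → Module.finrank F (Γ.comp g) ≤ 1) (hone : Γ.comp 1 ≤ Γ'.comp 1) :
    ¬ Γ'.IsProperRefinement Γ := by
  rintro ⟨-, h, hh, g, hlt⟩
  by_cases hg : g = 1
  · subst hg
    by_cases h1 : h = 1
    · subst h1
      exact absurd (hlt.trans_le hone) (lt_irrefl _)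
    · refine hh (disjoint_self.1 ?_)
      exact (Γ'.independent.pairwiseDisjoint h1).mono_right (hlt.le.trans hone)
  · have h1 := Submodule.finrank_lt_finrank_of_lt hlt
    have h2 := hdim g hg
    exact hh (Submodule.finrank_eq_zero.1 (by omega))

/-- The universal degrees for the first type. -/
theorem degree1_universal (i : Fin 10) :
    degree1 (Multiplicative.ofAdd ((1, 0) : ℤ × ℤ)) (Multiplicative.ofAdd (0, 1)) i =
      Multiplicative.ofAdd (![0, 0, 1, 1, -1, -1, 1, -1, 0, 0] i,
        ![0, 0, 1, -1, 1, -1, 0, 0, 1, -1] i) := by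
  fin_cases i <;> rfl

/-- The universal degrees for the second type. -/
theorem degree2_universal (i : Fin 10) :
    degree2 (Multiplicative.ofAdd ((1, 0) : ℤ × ZMod 2)) (Multiplicative.ofAdd (0, 1)) i =
      Multiplicative.ofAdd (![0, 0, 2, 0, 0, -2, 1, -1, 1, -1] i,
        ![0, 0, 1, 0, 1, 1, 0, 0, 1, 1] i) := by
  fin_cases i <;> rfl

theorem universal_sq : (Multiplicative.ofAdd ((0, 1) : ℤ × ZMod 2)) ^ 2 = 1 := rfl

/-- The universal grading of the first type. -/
def universal1 (F : Type w) [Field F] : Grading F (Multiplicative (ℤ × ℤ)) :=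
  gamma1 F (Multiplicative.ofAdd (1, 0)) (Multiplicative.ofAdd (0, 1))

/-- The universal grading of the second type. -/
def universal2 (hF : (2 : F) ≠ 0) : Grading F (Multiplicative (ℤ × ZMod 2)) :=
  gamma2 hF (Multiplicative.ofAdd (1, 0)) universal_sq

theorem finrank_universal1 (g : Multiplicative (ℤ × ℤ)) :
    Module.finrank F ((universal1 F).comp g) = (Finset.univ.filter fun i : Fin 10 =>
      Multiplicative.ofAdd ((![0, 0, 1, 1, -1, -1, 1, -1, 0, 0] i,
        ![0, 0, 1, -1, 1, -1, 0, 0, 1, -1] i) : ℤ × ℤ) = g).card := by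
  simp only [← degree1_universal]
  convert finrank_coordComp (ofCoord F) _ g
  rfl

theorem finrank_universal2 (hF : (2 : F) ≠ 0) (g : Multiplicative (ℤ × ZMod 2)) :
    Module.finrank F ((universal2 hF).comp g) = (Finset.univ.filter fun i : Fin 10 =>
      Multiplicative.ofAdd ((![0, 0, 2, 0, 0, -2, 1, -1, 1, -1] i,
        ![0, 0, 1, 0, 1, 1, 0, 0, 1, 1] i) : ℤ × ZMod 2) = g).card := by
  simp only [← degree2_universal]
  convert finrank_coordComp (ofSymmCoord hF) _ g
  rfl

theorem universal1_isFine (hF : (2 : F) ≠ 0) : IsFine.{v} (universal1 F) := by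
  intro H _ Γ' hΓ'
  refine not_isProperRefinement (fun g hg => ?_) ?_ hΓ'
  · rw [finrank_universal1, Finset.card_le_one]
    intro i hi j hj
    simp only [Finset.mem_filter, Finset.mem_univ, true_and] at hi hj
    rw [← hi] at hg hj
    clear hi
    revert i j
    decide
  · have hmem := isGamma1_iff_oddComp.1 ((isGamma1_iff (Γ := universal1 F) hF).2 rfl)
    have key {g} (hg : Module.finrank F ((universal1 F).comp g) = 1) {m}
        (hm : m ∈ (universal1 F).oddComp g) : ∃ h, m ∈ Γ'.oddComp h :=
      exists_mem_of_refinement hΓ'.1 hg hm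
    obtain ⟨h6, m6⟩ := key (by rw [finrank_universal1]; rfl) hmem.1
    obtain ⟨h7, m7⟩ := key (by rw [finrank_universal1]; rfl) hmem.2.1
    obtain ⟨h8, m8⟩ := key (by rw [finrank_universal1]; rfl) hmem.2.2.1
    obtain ⟨h9, m9⟩ := key (by rw [finrank_universal1]; rfl) hmem.2.2.2
    -- In the refinement the odd basis is still homogeneous; a nonzero value of the form forces
    -- inverse degrees, so the refinement is again of the first type.
    have e7 : h6 * h7 = 1 := by
      by_contra hc
      simpa [oddForm, K3.skew] using oddForm_eq_zero hF Γ' m6 m7 hc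
    have e9 : h8 * h9 = 1 := by
      by_contra hc
      simpa [oddForm, K3.skew] using oddForm_eq_zero hF Γ' m8 m9 hc
    rw [← inv_eq_of_mul_eq_one_right e7] at m7
    rw [← inv_eq_of_mul_eq_one_right e9] at m9
    rw [(isGamma1_iff hF).1 (isGamma1_iff_oddComp.2 ⟨m6, m7, m8, m9⟩)]
    intro X hX i hi
    refine hX i fun h => hi ?_
    rw [degree1_universal] at h
    have h01 : i = 0 ∨ i = 1 := by
      clear hi
      revert i
      decide
    rcases h01 with rfl | rfl <;> simp [degree1]

theorem universal2_isFine (hF : (2 : F) ≠ 0) : IsFine.{v} (universal2 hF) := by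
  intro H _ Γ' hΓ'
  refine not_isProperRefinement (fun g hg => ?_) ?_ hΓ'
  · rw [finrank_universal2, Finset.card_le_one]
    intro i hi j hj
    simp only [Finset.mem_filter, Finset.mem_univ, true_and] at hi hj
    rw [← hi] at hg hj
    clear hi
    revert i j
    decide
  · have hmem := isGamma2_iff_oddComp.1
      ((isGamma2_iff (Γ := universal2 hF) hF universal_sq).2 rfl)
    have key {g} (hg : Module.finrank F ((universal2 hF).comp g) = 1) {m}
        (hm : m ∈ (universal2 hF).oddComp g) : ∃ h, m ∈ Γ'.oddComp h :=
      exists_mem_of_refinement hΓ'.1 hg hm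
    obtain ⟨h6, m6⟩ := key (by rw [finrank_universal2]; rfl) hmem.1
    obtain ⟨h7, m7⟩ := key (by rw [finrank_universal2]; rfl) hmem.2.1
    obtain ⟨h8, m8⟩ := key (by rw [finrank_universal2]; rfl) hmem.2.2.1
    obtain ⟨h9, m9⟩ := key (by rw [finrank_universal2]; rfl) hmem.2.2.2
    have e7 : h6 * h7 = 1 := by
      by_contra hc
      have := oddForm_eq_zero hF Γ' m6 m7 hc
      simp [oddForm, K3.skew] at this
      exact hF (by linear_combination this)
    have e9 : h8 * h9 = 1 := by
      by_contra hc
      have := oddForm_eq_zero hF Γ' m8 m9 hc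
      simp [oddForm, K3.skew] at this
      exact hF (by linear_combination this)
    obtain rfl := inv_eq_of_mul_eq_one_right e7
    obtain rfl := inv_eq_of_mul_eq_one_right e9
    have hX := Γ'.mul_mem _ _ _ m6 _ m9
    have hY := Γ'.mul_mem _ _ _ m7 _ m8
    -- Both products equal the same nonzero multiple of `u ⊗ v + v ⊗ u`. Their degrees `h6 * h8⁻¹`
    -- and `h6⁻¹ * h8` therefore agree, which gives the element `h6⁻¹ * h8` of square `1`.
    have hXY : mul F (oddMap F (![1, 0], ![1, 0])) (oddMap F (![0, 1], -![0, 1]))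
        = mul F (oddMap F (![0, 1], ![0, 1])) (oddMap F (![1, 0], -![1, 0])) := by
      rw [oddMap_apply, oddMap_apply, oddMap_apply, oddMap_apply, ofCoord_mul, ofCoord_mul]
      congr 1
      ext i
      fin_cases i <;> simp
    have hX0 : mul F (oddMap F (![1, 0], ![1, 0])) (oddMap F (![0, 1], -![0, 1])) ≠ 0 := by
      have h4 : (4 : F) ≠ 0 := by
        have : (4 : F) = 2 * 2 := by norm_num
        rw [this]
        exact mul_ne_zero hF hF
      rw [oddMap_apply, oddMap_apply, ofCoord_mul, Ne, LinearEquiv.map_eq_zero_iff]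
      intro h
      have := congrFun h 3
      simp [h4] at this
    rw [← hXY] at hY
    have h68 : h6 * h8⁻¹ = h6⁻¹ * h8 := by
      by_contra hc
      exact hX0 (mem_eq_zero_of_ne Γ'.independent hc hX hY)
    have hsq : (h6⁻¹ * h8) ^ 2 = 1 := by
      rw [sq]
      nth_rewrite 1 [← h68]
      simp [mul_comm, mul_left_comm]
    have hmul : h6 * (h6⁻¹ * h8) = h8 := by simp
    rw [(isGamma2_iff hF hsq).1 (isGamma2_iff_oddComp.2 ⟨m6, m7, hmul.symm ▸ m8, hmul.symm ▸ m9⟩)]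
    intro X hX i hi
    refine hX i fun h => hi ?_
    rw [degree2_universal] at h
    have h013 : i = 0 ∨ i = 1 ∨ i = 3 := by
      clear hi
      revert i
      decide
    rcases h013 with rfl | rfl | rfl <;> simp [degree2]

/-- An automorphism fixes `1`, so it would match the identity components, of dimensions 2 and 3. -/
theorem not_equivalent_universal (hF : (2 : F) ≠ 0) :
    ¬ (universal1 F).Equivalent (universal2 hF) := by
  rintro ⟨φ, hφ, hc⟩
  have h1 : Module.finrank F ((universal1 F).comp 1) = 2 := by rw [finrank_universal1]; rfl
  have h2 : Module.finrank F ((universal2 hF).comp 1) = 3 := by rw [finrank_universal2]; rfl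
  obtain ⟨h, -, hh⟩ := hc 1 (by
    intro h
    rw [h, finrank_bot] at h1
    exact absurd h1 (by norm_num))
  have hone : one F ∈ (universal2 hF).comp h := by
    rw [← hh]
    exact ⟨one F, one_mem _, hφ.map_one⟩
  have h1h : h = 1 := by
    by_contra hne
    have := mem_eq_zero_of_ne (universal2 hF).independent hne hone (one_mem _)
    simp [one] at this
  subst h1h
  have := LinearEquiv.finrank_map_eq φ ((universal1 F).comp 1)
  rw [hh, h1, h2] at this
  exact absurd this (by norm_num)

/-- Pulling `Λ` back along the isomorphism gives a refinement of `Γ`. Fineness makes it improper, so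
`Γ` has, up to an automorphism, the components of `Λ`, which are components of `Θ`. -/
theorem equivalent_of_isFine {Γ Δ : Grading F G} (hΓ : IsFine.{v} Γ) (hiso : Γ.Iso Δ)
    {Λ : Grading F H} (hle : ∀ h, ∃ g, Λ.comp h ≤ Δ.comp g) {K : Type*} [CommGroup K]
    {Θ : Grading F K} (hΘ : ∀ h, ∃ k, Λ.comp h = Θ.comp k) : Γ.Equivalent Θ := by
  obtain ⟨φ, hφ, hc⟩ := hiso
  have hle' (h : H) : ∃ g, (Λ.map hφ.symm).comp h ≤ Γ.comp g := by
    obtain ⟨g, hg⟩ := hle h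
    refine ⟨g, ?_⟩
    rintro _ ⟨X, hX, rfl⟩
    have hX := hg hX
    rw [← hc] at hX
    obtain ⟨Y, hY, rfl⟩ := hX
    simpa using hY
  refine ⟨φ, hφ, fun g hg => ?_⟩
  obtain ⟨h, h0, hh⟩ := exists_comp_le hle' hg
  have heq : (Λ.map hφ.symm).comp h = Γ.comp g := by
    by_contra hne
    exact hΓ H (Λ.map hφ.symm) ⟨hle', h, h0, g, lt_of_le_of_ne hh hne⟩
  obtain ⟨k, hk⟩ := hΘ h
  have hmap : (Γ.comp g).map φ.toLinearMap = Θ.comp k := by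
    rw [← heq, ← hk]
    ext X
    simp [map]
  refine ⟨k, ?_, hmap⟩
  intro hbot
  rw [hbot] at hmap
  exact hg (Submodule.map_injective_of_injective φ.injective (by rw [hmap, Submodule.map_bot]))

theorem coordComp_le {D E : Type*} {e : (Fin 10 → F) ≃ₗ[F] K10 F} {d : Fin 10 → D}
    {d' : Fin 10 → E} (f : D → E) (hf : ∀ i, d' i = f (d i)) (x : D) :
    coordComp e d x ≤ coordComp e d' (f x) := fun _ hX i hi =>
  hX i fun h => hi (by rw [hf, h])

theorem coordComp_eq {D E : Type*} {e : (Fin 10 → F) ≃ₗ[F] K10 F} {d : Fin 10 → D}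
    {d' : Fin 10 → E} (f : D ≃ E) (hf : ∀ i, d' i = f (d i)) (x : D) :
    coordComp e d x = coordComp e d' (f x) := by
  refine le_antisymm (coordComp_le f hf x) ?_
  have := coordComp_le (e := e) (d := d') (d' := d) f.symm (fun i => by simp [hf]) (f x)
  rwa [f.symm_apply_apply] at this

theorem equivalent_universal1 (hF : (2 : F) ≠ 0) {Γ Δ : Grading F G} (hΓ : IsFine.{v} Γ)
    (hiso : Γ.Iso Δ) {g₁ g₂ : G} (hΔ : Δ.IsGamma1 g₁ g₂) : Γ.Equivalent (universal1 F) := by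
  -- Fineness only tests groups in universe `v`, so the universal group is lifted there before being
  -- used as a refinement.
  let E : ULift.{v} (Multiplicative (ℤ × ℤ)) ≃* Multiplicative (ℤ × ℤ) := MulEquiv.ulift
  have hE (i) : degree1 (Multiplicative.ofAdd ((1, 0) : ℤ × ℤ)) (Multiplicative.ofAdd (0, 1)) i
      = E (degree1 (E.symm (Multiplicative.ofAdd (1, 0))) (E.symm (Multiplicative.ofAdd (0, 1)))
        i) := by
    simp [degree1]
  refine equivalent_of_isFine hΓ hiso
    (Λ := gamma1 F (E.symm (Multiplicative.ofAdd (1, 0))) (E.symm (Multiplicative.ofAdd (0, 1))))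
    (fun h => ⟨g₁ ^ (E h).toAdd.1 * g₂ ^ (E h).toAdd.2, ?_⟩)
    (fun h => ⟨E h, coordComp_eq E.toEquiv hE h⟩)
  rw [(isGamma1_iff hF).1 hΔ]
  refine coordComp_le (fun h => g₁ ^ (E h).toAdd.1 * g₂ ^ (E h).toAdd.2) (fun i => ?_) h
  rw [← hE, degree1_universal]
  rfl

theorem equivalent_universal2 (hF : (2 : F) ≠ 0) {Γ Δ : Grading F G} (hΓ : IsFine.{v} Γ)
    (hiso : Γ.Iso Δ) {g h : G} (hh : h ^ 2 = 1) (hΔ : Δ.IsGamma2 g h) :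
    Γ.Equivalent (universal2 hF) := by
  let E : ULift.{v} (Multiplicative (ℤ × ZMod 2)) ≃* Multiplicative (ℤ × ZMod 2) := MulEquiv.ulift
  have hE (i) : degree2 (Multiplicative.ofAdd ((1, 0) : ℤ × ZMod 2)) (Multiplicative.ofAdd (0, 1)) i
      = E (degree2 (E.symm (Multiplicative.ofAdd (1, 0))) (E.symm (Multiplicative.ofAdd (0, 1)))
        i) := by
    simp [degree2]
  have hsq : (E.symm (Multiplicative.ofAdd (0, 1))) ^ 2 = 1 := by
    rw [← map_pow, universal_sq, map_one]
  refine equivalent_of_isFine hΓ hiso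
    (Λ := gamma2 hF (E.symm (Multiplicative.ofAdd (1, 0))) hsq)
    (fun x => ⟨g ^ (E x).toAdd.1 * h ^ (E x).toAdd.2.val, ?_⟩)
    (fun x => ⟨E x, coordComp_eq E.toEquiv hE x⟩)
  rw [(isGamma2_iff hF hh).1 hΔ]
  -- Coarsening needs only a function on degrees that is right on the ten basis degrees, so
  -- representatives in `{0, 1}` of the `ℤ/2` exponents suffice.
  refine coordComp_le (fun x => g ^ (E x).toAdd.1 * h ^ (E x).toAdd.2.val) (fun i => ?_) x
  rw [← hE, degree2_universal]
  fin_cases i <;> simp [degree2, ZMod.val_one]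

end Grading

end

end Kac

end

theorem theorem3p5 (F : Type w) [Field F] (hF : (2 : F) ≠ 0) (G : Type u) [CommGroup G] :
    -- the gradings of the two types are well defined
    (∀ g₁ g₂ : G, ∃! Γ : Kac.Grading F G, Γ.IsGamma1 g₁ g₂) ∧
    (∀ g h : G, h ^ 2 = 1 → h ≠ 1 → ∃! Γ : Kac.Grading F G, Γ.IsGamma2 g h) ∧
    -- every grading is isomorphic to one of them
    (∀ Γ : Kac.Grading F G,
      (∃ (g₁ g₂ : G) (Γ' : Kac.Grading F G), Γ'.IsGamma1 g₁ g₂ ∧ Γ.Iso Γ') ∨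
      (∃ (g h : G) (Γ' : Kac.Grading F G), h ^ 2 = 1 ∧ h ≠ 1 ∧ Γ'.IsGamma2 g h ∧ Γ.Iso Γ')) ∧
    -- the two types are not isomorphic
    (∀ (g₁ g₂ g h : G) (Γ Γ' : Kac.Grading F G), h ^ 2 = 1 → h ≠ 1 →
      Γ.IsGamma1 g₁ g₂ → Γ'.IsGamma2 g h → ¬ Γ.Iso Γ') ∧
    -- isomorphism within the first type
    (∀ (g₁ g₂ g₁' g₂' : G) (Γ Γ' : Kac.Grading F G),
      Γ.IsGamma1 g₁ g₂ → Γ'.IsGamma1 g₁' g₂' →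
      (Γ.Iso Γ' ↔
        ({g₁, g₁⁻¹, g₂, g₂⁻¹} : Set G) = {g₁', g₁'⁻¹, g₂', g₂'⁻¹})) ∧
    -- isomorphism within the second type
    (∀ (g h g' h' : G) (Γ Γ' : Kac.Grading F G),
      h ^ 2 = 1 → h ≠ 1 → h' ^ 2 = 1 → h' ≠ 1 →
      Γ.IsGamma2 g h → Γ'.IsGamma2 g' h' →
      (Γ.Iso Γ' ↔ h' = h ∧ g' ∈ ({g, g * h, g⁻¹, g⁻¹ * h} : Set G))) ∧
    -- exactly two fine gradings up to equivalence
    (∃ (Γ₁ : Kac.Grading F (Multiplicative (ℤ × ℤ)))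
      (Γ₂ : Kac.Grading F (Multiplicative (ℤ × ZMod 2))),
      Γ₁.IsGamma1 (Multiplicative.ofAdd (1, 0)) (Multiplicative.ofAdd (0, 1)) ∧
      Γ₂.IsGamma2 (Multiplicative.ofAdd (1, 0)) (Multiplicative.ofAdd (0, 1)) ∧
      Kac.Grading.IsFine.{v} Γ₁ ∧ Kac.Grading.IsFine.{v} Γ₂ ∧
      ¬ Γ₁.Equivalent Γ₂ ∧
      ∀ Γ : Kac.Grading F G, Kac.Grading.IsFine.{v} Γ →
        (Γ.Equivalent Γ₁ ∨ Γ.Equivalent Γ₂)) := by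
  refine ⟨Kac.Grading.existsUnique_isGamma1 hF,
    fun g h hh _ => Kac.Grading.existsUnique_isGamma2 hF g hh, Kac.Grading.exists_isGamma hF,
    ?_, fun _ _ _ _ _ _ h h' => h.iso_iff hF h',
    fun _ _ _ _ _ _ hh _ hh' _ H H' => H.iso_iff hF hh hh' H',
    Kac.Grading.universal1 F, Kac.Grading.universal2 hF,
    (Kac.Grading.isGamma1_iff hF).2 rfl,
    (Kac.Grading.isGamma2_iff hF Kac.Grading.universal_sq).2 rfl,
    Kac.Grading.universal1_isFine hF, Kac.Grading.universal2_isFine hF,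
    Kac.Grading.not_equivalent_universal hF, fun Γ hΓ => ?_⟩
  · intro g₁ g₂ g h Γ Γ' hh h1 H H' hi
    refine h1 ?_
    rw [← H'.detDegree_eq hF hh, ← hi.detDegree_eq, H.detDegree_eq hF]
  · rcases Kac.Grading.exists_isGamma hF Γ with ⟨g₁, g₂, Δ, hΔ, hi⟩ | ⟨g, h, Δ, hh, -, hΔ, hi⟩
    · exact Or.inl (Kac.Grading.equivalent_universal1 hF hΓ hi hΔ)
    · exact Or.inr (Kac.Grading.equivalent_universal2 hF hΓ hi hh hΔ)
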